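/- Let $K$ be a countable index set. A weight is a function $m\colon K\to(0,\infty)$; products, quotients and square roots of weights are taken pointwise. For $1\le p\le\infty$ let $\ell^p_m(K)=\{c\in\mathbb C^K : m\cdot c\in\ell^p(K)\}$ with norm $\|c\|_{\ell^p_m}=\|m\cdot c\|_{\ell^p}$. An *ARI-algebra* is a Banach $*$-algebra $\mathcal A$ of matrices over $K$ (containing the identity matrix, with the conjugate transpose as involution), together with a class $W$ of weights, called $\mathcal A$-admissible, such that (1) $1\in W$; if $m\in W$ then $1/m\in W$; and every $A\in\mathcal A$ defines a bounded operator on $\ell^p_m(K)$ for all $1\le p\le\infty$ and $m\in W$; (2) $\mathcal A$ is inverse-closed in $\mathcal B(\ell^2(K))$: if $A\in\mathcal A$ is invertible on $\ell^2(K)$, then $A^{-1}\in\mathcal A$. Let $\Psi=(\psi_k)_{k\in K}$ be a frame for a complex Hilbert space $\mathcal H$, with frame operator $S_\Psi f=\sum_k\langle f,\psi_k\rangle\psi_k$, canonical dual frame $\tilde\psi_k=S_\Psi^{-1}\psi_k$ and Gram matrix $(G_\Psi)_{kl}=\langle\psi_l,\psi_k\rangle$. The frame $\Psi$ is *$\mathcal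 A$-localized* if $G_\Psi\in\mathcal A$. Let $\mathcal H^{00}=\operatorname{span}\{\psi_k:k\in K\}$ and $C_{\tilde\Psi}f=(\langle f,\tilde\psi_k\rangle)_{k}$. For $1\le p<\infty$ the *coorbit space* $\mathcal H^p_m$ is the completion of $\mathcal H^{00}$ in the norm $\|f\|_{\mathcal H^p_m}=\|C_{\tilde\Psi}f\|_{\ell^p_m}$. The space $\mathcal H^\infty_m$ is the weak-$*$ completion: its elements are the classes of sequences $(f_n)$ in $\mathcal H^{00}$ with $\sup_n\|C_{\tilde\Psi}f_n\|_{\ell^\infty_m}<\infty$ for which $\langle f,\tilde\psi_k\rangle:=\lim_n\langle f_n,\tilde\psi_k\rangle$ exists for every $k$, two sequences being identified if these limits agree, with norm $\sup_k m_k|\langle f,\tilde\psi_k\rangle|$. The functionals $\langle\cdot,\tilde\psi_k\rangle$ extend to $\mathcal H^p_m$; for $f\in\mathcal H^p_m$ put $\langle f,\psi_k\rangle=\sum_l\langle f,\tilde\psi_l\rangle\langle\psi_l,\psi_k\rangle$, and for $f\in \mathcal H^\infty_m$, $g\in\mathcal H^1_{1/m}$ put $\langle f,g\rangle=\sum_k\langle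 f,\tilde\psi_k\rangle\overline{\langle g,\psi_k\rangle}$. For a weight $\mu$, the *frame multiplier* is $$M_{\mu,\Psi}f=\sum_{k\in K}\mu_k\langle f,\psi_k\rangle\psi_k ,$$ where, as a map from $\mathcal H^p_{m}$ to $\mathcal H^p_{w}$, the series is required to converge unconditionally in the norm of $\mathcal H^p_w$ if $p<\infty$, and unconditionally in the weak-$*$ sense (tested against $\mathcal H^1_{1/w}$) if $p=\infty$. **Theorem (Abstract lifting theorem for coorbit spaces).** Let $\mathcal A$ be an ARI-algebra, let $\mu$ and $m$ be weights such that $\mu$, $m\sqrt\mu$ and $m/\sqrt\mu$ are $\mathcal A$-admissible, and let $\Psi$ be an $\mathcal A$-localized frame for which also $G_\Psi^\mu:=\operatorname{diag}(\mu)\,G_\Psi\,\operatorname{diag}(1/\mu)\in\mathcal A$. Then for every $1\le p\le\infty$ the spaces $\mathcal H^p_{m\sqrt\mu}$ and $\mathcal H^p_{m/\sqrt\mu}$ are well-defined Banach spaces (containing all the vectors $\psi_k$), the frame multiplier $M_{\mu,\Psi}$ is well defined and is a Banach space isomorphism (a bounded linear bijection with bounded inverse) from $\mathcal H^p_{m\sqrt\mu}$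 onto $\mathcal H^p_{m/\sqrt\mu}$, and the frame multiplier $M_{1/\mu,\Psi}$ is well defined and is a Banach space isomorphism from $\mathcal H^p_{m/\sqrt\mu}$ onto $\mathcal H^p_{m\sqrt\mu}$. -/

import Mathlib

open scoped ENNReal ComplexConjugate InnerProductSpace

noncomputable section

universe u v

/-! ## Weights -/

/-- A (strictly positive) weight on the index set `K`. -/
structure PosWeight (K : Type u) where
  /-- the values of the weight -/
  val : K → ℝ
  pos : ∀ k, 0 < val k

namespace PosWeight

variable {K : Type u}

instance : CoeFun (PosWeight K) (fun _ => K → ℝ) := ⟨PosWeight.val⟩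

/-- The constant weight `1`. -/
instance : One (PosWeight K) := ⟨⟨fun _ => 1, fun _ => one_pos⟩⟩

/-- Pointwise reciprocal `1 / m`. -/
instance : Inv (PosWeight K) := ⟨fun m => ⟨fun k => (m k)⁻¹, fun k => inv_pos.2 (m.pos k)⟩⟩

/-- Pointwise product. -/
instance : Mul (PosWeight K) :=
  ⟨fun m w => ⟨fun k => m k * w k, fun k => mul_pos (m.pos k) (w.pos k)⟩⟩

/-- Pointwise quotient. -/
instance : Div (PosWeight K) :=
  ⟨fun m w => ⟨fun k => m k / w k, fun k => div_pos (m.pos k) (w.pos k)⟩⟩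

/-- Pointwise square root. -/
def sqrt (m : PosWeight K) : PosWeight K :=
  ⟨fun k => Real.sqrt (m k), fun k => Real.sqrt_pos.2 (m.pos k)⟩

end PosWeight

/-! ## Weighted sequence spaces -/

/-- Multiplication of a sequence by a weight, `(diag(m) c)_k = m_k c_k`. -/
def diagMul {K : Type u} (m : PosWeight K) :
    PreLp (fun _ : K => ℂ) →ₗ[ℂ] PreLp (fun _ : K => ℂ) where
  toFun c := fun k => (m k : ℂ) * c k
  map_add' c d := by
    funext k
    exact mul_add _ _ _
  map_smul' a c := by
    funext k
    exact mul_left_comm _ _ _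

/-- The weighted space `ℓ^p_m(K)` of all `c : K → ℂ` with `m · c ∈ ℓ^p(K)`. -/
def WeightedLp {K : Type u} (m : PosWeight K) (p : ℝ≥0∞) :
    Submodule ℂ (PreLp (fun _ : K => ℂ)) :=
  (lpSubmodule ℂ (fun _ : K => ℂ) p).comap (diagMul m)

namespace WeightedLp

variable {K : Type u} (m : PosWeight K) (p : ℝ≥0∞)

/-- The map `c ↦ m · c` from `ℓ^p_m(K)` to `ℓ^p(K)`. -/
def toLp : WeightedLp m p →ₗ[ℂ] lp (fun _ : K => ℂ) p where
  toFun c := ⟨diagMul m c.1, c.2⟩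
  map_add' c d := Subtype.ext (map_add (diagMul m) c.1 d.1)
  map_smul' a c := Subtype.ext (map_smul (diagMul m) a c.1)

theorem toLp_injective : Function.Injective (toLp m p) := by
  intro c d h
  apply Subtype.ext
  funext k
  have h1 : (m k : ℂ) * c.1 k = (m k : ℂ) * d.1 k := congrFun (congrArg Subtype.val h) k
  exact mul_left_cancel₀ (Complex.ofReal_ne_zero.2 (m.pos k).ne') h1

variable [Fact (1 ≤ p)]

/-- The norm `‖c‖_{ℓ^p_m} = ‖m · c‖_{ℓ^p}`. -/
instance : NormedAddCommGroup (WeightedLp m p) :=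
  NormedAddCommGroup.induced (WeightedLp m p) (lp (fun _ : K => ℂ) p) (toLp m p)
    (toLp_injective m p)

instance : NormedSpace ℂ (WeightedLp m p) :=
  NormedSpace.induced ℂ (WeightedLp m p) (lp (fun _ : K => ℂ) p) (toLp m p)

theorem norm_def (c : WeightedLp m p) : ‖c‖ = ‖toLp m p c‖ := rfl

end WeightedLp

/-! ## Matrices over `K` and ARI-algebras -/

/-- The matrix `M` acts as a bounded operator on `ℓ^p_m(K)`: for every `c ∈ ℓ^p_m` the series
`∑_l M_{kl} c_l` converge, they define an element `d` of `ℓ^p_m`, and `‖d‖ ≤ C ‖c‖`. -/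
def ActsBoundedly {K : Type u} (M : Matrix K K ℂ) (p : ℝ≥0∞) [Fact (1 ≤ p)]
    (m : PosWeight K) : Prop :=
  ∃ C : ℝ, ∀ c : WeightedLp m p, ∃ d : WeightedLp m p,
    (∀ k, HasSum (fun l => M k l * c.1 l) (d.1 k)) ∧ ‖d‖ ≤ C * ‖c‖

open scoped Classical in
/-- The matrix `(⟨T e_l, e_k⟩)_{kl}` of a bounded operator on `ℓ²(K)`. -/
def opMatrix {K : Type u}
    (T : lp (fun _ : K => ℂ) 2 →L[ℂ] lp (fun _ : K => ℂ) 2) : Matrix K K ℂ :=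
  fun k l => T (lp.single 2 l 1) k

/-- An ARI-algebra over `K`: a unital Banach `*`-algebra of matrices over `K` with a class `W` of
admissible weights, satisfying regularity and inverse-closedness. Since the constant weight `1` is
admissible, every matrix of the algebra is bounded on `ℓ²(K)`; the algebra is recorded as the
`*`-algebra of the corresponding operators (operator product and adjoint are matrix product and
conjugate transpose), endowed with a complete submultiplicative norm of its own. -/
structure ARIAlgebra (K : Type u) where
  /-- the underlying unital `*`-algebra -/
  alg : StarSubalgebra ℂ (lp (fun _ : K => ℂ) 2 →L[ℂ] lp (fun _ : K => ℂ) 2)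
  /-- the Banach algebra norm -/
  algNorm : AlgebraNorm ℂ alg
  complete : ∀ a : ℕ → alg,
    (∀ ε : ℝ, 0 < ε → ∃ N, ∀ i ≥ N, ∀ j ≥ N, algNorm (a i - a j) < ε) →
    ∃ b : alg, Filter.Tendsto (fun i => algNorm (a i - b)) Filter.atTop (nhds 0)
  /-- the class of admissible weights -/
  W : Set (PosWeight K)
  one_mem : 1 ∈ W
  inv_mem : ∀ m ∈ W, m⁻¹ ∈ W
  /-- regularity -/
  regular : ∀ T ∈ alg, ∀ m ∈ W, ∀ (p : ℝ≥0∞) [Fact (1 ≤ p)], ActsBoundedly (opMatrix T) p m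
  /-- inverse-closedness in the bounded operators on `ℓ²(K)` -/
  inverse_closed : ∀ T ∈ alg, IsUnit T → Ring.inverse T ∈ alg

/-- The matrix `M` belongs to the matrix algebra `A`. -/
def ARIAlgebra.MemMatrix {K : Type u} (A : ARIAlgebra K) (M : Matrix K K ℂ) : Prop :=
  ∃ T ∈ A.alg, opMatrix T = M

/-- The conjugated matrix `M^μ = diag(μ) M diag(1/μ)`. -/
def conjDiag {K : Type u} (μ : PosWeight K) (M : Matrix K K ℂ) : Matrix K K ℂ :=
  fun k l => (μ k : ℂ) * M k l * ((μ l)⁻¹ : ℝ)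

/-! ## Frames -/

/-- A frame `(ψ_k)_{k ∈ K}` of the Hilbert space `H`. -/
structure HilbertFrame (K : Type u) (H : Type v) [NormedAddCommGroup H]
    [InnerProductSpace ℂ H] where
  /-- the frame vectors -/
  vec : K → H
  isFrame : ∃ a b : ℝ, 0 < a ∧ 0 < b ∧ ∀ f : H,
    (Summable fun k => ‖⟪vec k, f⟫_ℂ‖ ^ 2) ∧
    a * ‖f‖ ^ 2 ≤ ∑' k, ‖⟪vec k, f⟫_ℂ‖ ^ 2 ∧ ∑' k, ‖⟪vec k, f⟫_ℂ‖ ^ 2 ≤ b * ‖f‖ ^ 2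

namespace HilbertFrame

variable {K : Type u} {H : Type v} [NormedAddCommGroup H] [InnerProductSpace ℂ H]
variable (Ψ : HilbertFrame K H)

theorem memlp_coeff (f : H) : Memℓp (fun k => ⟪Ψ.vec k, f⟫_ℂ) 2 := by
  obtain ⟨a, b, -, -, h⟩ := Ψ.isFrame
  refine memℓp_gen ?_
  simpa using (h f).1

/-- The analysis operator as a linear map. -/
def analysisLin : H →ₗ[ℂ] lp (fun _ : K => ℂ) 2 where
  toFun f := ⟨fun k => ⟪Ψ.vec k, f⟫_ℂ, Ψ.memlp_coeff f⟩
  map_add' f g := by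
    apply Subtype.ext
    funext k
    exact inner_add_right _ _ _
  map_smul' c f := by
    apply Subtype.ext
    funext k
    exact inner_smul_right _ _ _

theorem norm_sq_analysisLin (f : H) :
    ‖Ψ.analysisLin f‖ ^ 2 = ∑' k, ‖⟪Ψ.vec k, f⟫_ℂ‖ ^ 2 := by
  have h := lp.norm_rpow_eq_tsum (p := 2) (by norm_num) (Ψ.analysisLin f)
  simpa [analysisLin] using h

theorem analysisLin_bound : ∃ C : ℝ, ∀ f : H, ‖Ψ.analysisLin f‖ ≤ C * ‖f‖ := by
  obtain ⟨a, b, -, hb, h⟩ := Ψ.isFrame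
  refine ⟨Real.sqrt b, fun f => ?_⟩
  refine (abs_le_of_sq_le_sq' ?_ (by positivity)).2
  rw [norm_sq_analysisLin, mul_pow, Real.sq_sqrt hb.le]
  exact (h f).2.2

/-- The analysis operator `C_Ψ : H → ℓ²(K)`, `(C_Ψ f)_k = ⟨f, ψ_k⟩`. -/
def analysis : H →L[ℂ] lp (fun _ : K => ℂ) 2 :=
  Ψ.analysisLin.mkContinuousOfExistsBound Ψ.analysisLin_bound

theorem analysis_apply (f : H) (k : K) : Ψ.analysis f k = ⟪Ψ.vec k, f⟫_ℂ := rfl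

/-- The Gram matrix `(G_Ψ)_{kl} = ⟨ψ_l, ψ_k⟩`. -/
def gram : Matrix K K ℂ := fun k l => ⟪Ψ.vec k, Ψ.vec l⟫_ℂ

variable [CompleteSpace H]

/-- The frame operator `S_Ψ = D_Ψ C_Ψ`, where `D_Ψ = C_Ψ^*`. -/
def frameOp : H →L[ℂ] H := Ψ.analysis.adjoint ∘L Ψ.analysis

theorem inner_frameOp (g f : H) :
    ⟪g, Ψ.frameOp f⟫_ℂ = ⟪Ψ.analysis g, Ψ.analysis f⟫_ℂ := by
  rw [frameOp, ContinuousLinearMap.comp_apply, ContinuousLinearMap.adjoint_inner_right]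

open scoped Classical in
/-- `S_Ψ f = ∑_k ⟨f, ψ_k⟩ ψ_k`. -/
theorem hasSum_frameOp (f : H) : HasSum (fun k => ⟪Ψ.vec k, f⟫_ℂ • Ψ.vec k) (Ψ.frameOp f) := by
  have h1 := lp.hasSum_single (p := 2) (by norm_num) (Ψ.analysis f)
  have h2 := h1.mapL Ψ.analysis.adjoint
  have h3 : ∀ k, Ψ.analysis.adjoint (lp.single 2 k (Ψ.analysis f k))
      = ⟪Ψ.vec k, f⟫_ℂ • Ψ.vec k := by
    intro k
    refine ext_inner_left ℂ fun g => ?_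
    rw [ContinuousLinearMap.adjoint_inner_right, lp.inner_single_right, inner_smul_right,
      analysis_apply, analysis_apply, ← inner_conj_symm g]
    simp
  simp only [h3] at h2
  exact h2

theorem isUnit_frameOp : IsUnit Ψ.frameOp := by
  obtain ⟨a, b, ha, -, h⟩ := Ψ.isFrame
  refine ContinuousLinearMap.isUnit_of_forall_le_norm_inner_map Ψ.frameOp
    (c := ⟨a, ha.le⟩) ha fun f => ?_
  rw [← inner_conj_symm, RCLike.norm_conj, inner_frameOp, inner_self_eq_norm_sq_to_K]
  have h1 : ‖Ψ.analysis f‖ ^ 2 = ∑' k, ‖⟪Ψ.vec k, f⟫_ℂ‖ ^ 2 := Ψ.norm_sq_analysisLin f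
  rw [norm_pow, RCLike.norm_ofReal, abs_norm, h1, mul_comm]
  exact (h f).2.1

/-- The canonical dual frame `ψ̃_k = S_Ψ⁻¹ ψ_k`. -/
def dual (k : K) : H := (Ring.inverse Ψ.frameOp) (Ψ.vec k)

theorem frameOp_inverse (f : H) : Ψ.frameOp ((Ring.inverse Ψ.frameOp) f) = f := by
  have h := Ring.mul_inverse_cancel Ψ.frameOp Ψ.isUnit_frameOp
  exact congrArg (fun T : H →L[ℂ] H => T f) h

theorem frameOp_dual (k : K) : Ψ.frameOp (Ψ.dual k) = Ψ.vec k := Ψ.frameOp_inverse _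

theorem inner_inverse_frameOp (g f : H) :
    ⟪(Ring.inverse Ψ.frameOp) g, f⟫_ℂ = ⟪g, (Ring.inverse Ψ.frameOp) f⟫_ℂ := by
  have hS : ∀ x y : H, ⟪Ψ.frameOp x, y⟫_ℂ = ⟪x, Ψ.frameOp y⟫_ℂ := by
    intro x y
    rw [← inner_conj_symm, inner_frameOp, inner_frameOp, inner_conj_symm]
  calc ⟪(Ring.inverse Ψ.frameOp) g, f⟫_ℂ
      = ⟪(Ring.inverse Ψ.frameOp) g, Ψ.frameOp ((Ring.inverse Ψ.frameOp) f)⟫_ℂ := by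
        rw [frameOp_inverse]
    _ = ⟪g, (Ring.inverse Ψ.frameOp) f⟫_ℂ := by rw [← hS, frameOp_inverse]

/-- The frame reconstruction formula `f = ∑_k ⟨f, ψ̃_k⟩ ψ_k`. -/
theorem hasSum_dual (f : H) : HasSum (fun k => ⟪Ψ.dual k, f⟫_ℂ • Ψ.vec k) f := by
  have h := Ψ.hasSum_frameOp ((Ring.inverse Ψ.frameOp) f)
  rw [frameOp_inverse] at h
  simpa only [dual, inner_inverse_frameOp] using h

/-- The sequence of dual frame coefficients `C_{Ψ̃} f = (⟨f, ψ̃_k⟩)_k`. -/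
def dualCoeff : H →ₗ[ℂ] PreLp (fun _ : K => ℂ) where
  toFun f := fun k => ⟪Ψ.dual k, f⟫_ℂ
  map_add' f g := by
    funext k
    exact inner_add_right _ _ _
  map_smul' c f := by
    funext k
    exact inner_smul_right _ _ _

/-- The subspace `H⁰⁰` of finite linear combinations of the frame vectors. -/
def finSpan : Submodule ℂ H := Submodule.span ℂ (Set.range Ψ.vec)

end HilbertFrame

/-! ## Coorbit spaces

An element of the coorbit space `H^p_m` is represented by the sequence of its dual frame
coefficients `(⟨f, ψ̃_k⟩)_k`, and `f ∈ H⁰⁰` is identified with `C_{Ψ̃} f`. The norm of `H^p_m` is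
then the norm of `ℓ^p_m`. -/

section Coorbit

variable {K : Type u} {H : Type v} [NormedAddCommGroup H] [InnerProductSpace ℂ H]
  [CompleteSpace H]

/-- The image in `ℓ^p_m` of `H⁰⁰` under the isometric map `f ↦ C_{Ψ̃} f`. -/
def finCoorbit (Ψ : HilbertFrame K H) (p : ℝ≥0∞) (m : PosWeight K) :
    Submodule ℂ (WeightedLp m p) :=
  (Ψ.finSpan.map Ψ.dualCoeff).comap (WeightedLp m p).subtype

/-- The weak-`*` completion of `H⁰⁰`, used for `p = ∞`: an element is given by a sequence `(f_n)`
in `H⁰⁰` that is bounded in the norm `‖C_{Ψ̃} f‖_{ℓ^∞_m}` and for which `⟨f_n, ψ̃_k⟩` converges for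
every `k`; two sequences are identified if these limits coincide. -/
def weakStarCoorbit (Ψ : HilbertFrame K H) (p : ℝ≥0∞) (m : PosWeight K) :
    Submodule ℂ (WeightedLp m p) where
  carrier := {c | ∃ f : ℕ → H, (∀ n, f n ∈ Ψ.finSpan) ∧
    (∃ B : ℝ, ∀ n k, m k * ‖⟪Ψ.dual k, f n⟫_ℂ‖ ≤ B) ∧
    ∀ k, Filter.Tendsto (fun n => ⟪Ψ.dual k, f n⟫_ℂ) Filter.atTop (nhds (c.1 k))}
  zero_mem' := by
    refine ⟨fun _ => 0, fun _ => Submodule.zero_mem _, ⟨0, fun n k => by simp⟩, fun k => ?_⟩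
    simp only [inner_zero_right]
    exact tendsto_const_nhds
  add_mem' := by
    rintro c d ⟨f, hf, ⟨B, hB⟩, hfc⟩ ⟨g, hg, ⟨B', hB'⟩, hgd⟩
    refine ⟨fun n => f n + g n, fun n => Submodule.add_mem _ (hf n) (hg n),
      ⟨B + B', fun n k => ?_⟩, fun k => ?_⟩
    · rw [inner_add_right]
      calc m k * ‖⟪Ψ.dual k, f n⟫_ℂ + ⟪Ψ.dual k, g n⟫_ℂ‖
          ≤ m k * (‖⟪Ψ.dual k, f n⟫_ℂ‖ + ‖⟪Ψ.dual k, g n⟫_ℂ‖) :=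
            mul_le_mul_of_nonneg_left (norm_add_le _ _) (m.pos k).le
        _ ≤ B + B' := by rw [mul_add]; exact add_le_add (hB n k) (hB' n k)
    · simp only [inner_add_right]
      exact (hfc k).add (hgd k)
  smul_mem' := by
    rintro a c ⟨f, hf, ⟨B, hB⟩, hfc⟩
    refine ⟨fun n => a • f n, fun n => Submodule.smul_mem _ a (hf n),
      ⟨‖a‖ * B, fun n k => ?_⟩, fun k => ?_⟩
    · rw [inner_smul_right, norm_mul, mul_left_comm]
      exact mul_le_mul_of_nonneg_left (hB n k) (norm_nonneg a)
    · simp only [inner_smul_right]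
      exact (hfc k).const_mul a

open scoped Classical in
/-- The coorbit space `H^p_m`: for `p < ∞` the completion of `H⁰⁰` in the norm
`‖C_{Ψ̃} f‖_{ℓ^p_m}`, that is, the closure of its isometric image in the Banach space `ℓ^p_m`; for
`p = ∞` the weak-`*` completion. -/
def CoorbitSpace (Ψ : HilbertFrame K H) (p : ℝ≥0∞) [Fact (1 ≤ p)] (m : PosWeight K) :
    Submodule ℂ (WeightedLp m p) :=
  if p = ∞ then weakStarCoorbit Ψ p m else (finCoorbit Ψ p m).topologicalClosure

/-- The frame coefficient `⟨f, ψ_k⟩ = ∑_l ⟨f, ψ̃_l⟩ ⟨ψ_l, ψ_k⟩` of an element `f` that is given by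
its dual frame coefficients `c_l = ⟨f, ψ̃_l⟩`. -/
def frameCoeff (Ψ : HilbertFrame K H) (c : PreLp (fun _ : K => ℂ)) (k : K) : ℂ :=
  ∑' l, c l * ⟪Ψ.vec k, Ψ.vec l⟫_ℂ

/-- On the Hilbert space `frameCoeff` is the usual frame coefficient `⟨f, ψ_k⟩`. -/
theorem frameCoeff_dualCoeff (Ψ : HilbertFrame K H) (f : H) (k : K) :
    frameCoeff Ψ (Ψ.dualCoeff f) k = ⟪Ψ.vec k, f⟫_ℂ := by
  have h := (Ψ.hasSum_dual f).mapL (innerSL ℂ (Ψ.vec k))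
  simp only [innerSL_apply_apply, inner_smul_right] at h
  exact h.tsum_eq

/-- The duality `⟨f, g⟩ = ∑_k ⟨f, ψ̃_k⟩ conj ⟨g, ψ_k⟩` between `H^p_m` and `H^{p'}_{1/m}`, where `f`
and `g` are given by their dual frame coefficients. -/
def coorbitPairing (Ψ : HilbertFrame K H) (c d : PreLp (fun _ : K => ℂ)) : ℂ :=
  ∑' k, c k * conj (frameCoeff Ψ d k)

/-- The map `T : H^p_m → H^p_w` is the frame multiplier `f ↦ ∑_k μ_k ⟨f, ψ_k⟩ ψ_k`.

The first part says that the frame vectors `ψ_k` (as sequences, `C_{Ψ̃} ψ_k`) lie in `H^p_w`. Then,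
for every `f ∈ H^p_m`, the series defining `⟨f, ψ_k⟩` converge, and `T f` is the unconditional sum
of `μ_k ⟨f, ψ_k⟩ ψ_k`, in the norm of `H^p_w` for `p < ∞` and in the weak-`*` sense, tested against
`H^1_{1/w}`, for `p = ∞`. -/
def IsFrameMultiplier (Ψ : HilbertFrame K H) (μ : PosWeight K) {p : ℝ≥0∞} [Fact (1 ≤ p)]
    {m w : PosWeight K} (T : CoorbitSpace Ψ p m → CoorbitSpace Ψ p w) : Prop :=
  ∃ e : K → CoorbitSpace Ψ p w, (∀ k, (e k).1.1 = Ψ.dualCoeff (Ψ.vec k)) ∧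
    ∀ f : CoorbitSpace Ψ p m,
      (∀ k, Summable fun l => f.1.1 l * ⟪Ψ.vec k, Ψ.vec l⟫_ℂ) ∧
      (p ≠ ∞ → HasSum (fun k => ((μ k : ℂ) * frameCoeff Ψ f.1.1 k) • e k) (T f)) ∧
      (p = ∞ → ∀ g : CoorbitSpace Ψ 1 w⁻¹,
        (Summable fun k => (T f).1.1 k * conj (frameCoeff Ψ g.1.1 k)) ∧
        HasSum (fun k => (μ k : ℂ) * frameCoeff Ψ f.1.1 k * coorbitPairing Ψ (e k).1.1 g.1.1)
          (coorbitPairing Ψ (T f).1.1 g.1.1))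

end Coorbit

end

/-!
The Gram operator `G` of the frame has a group inverse `L`, the Gram operator of the dual frame, and
`P = L * G` is the projection onto the range of the analysis operator. Writing `L` as a Riesz
integral of the resolvent of `G` shows that `L` and `P` belong to the algebra, so that `P` acts on
every `ℓ^p_w(K)` with `w` admissible; its fixed points form the coorbit space. There the multiplier
with symbol `μ` is `P * diag(μ) * G`, hence `M_{1/μ} * M_μ` is `X = P * N * G` where
`N = diag(1/μ) * G * diag(μ)`.

It remains to find a group inverse of `X` in the algebra. Conjugation by `√μ`, bounded on `ℓ²(K)` by
interpolation although `√μ` need not be admissible, turns `N * G` into `V* V`, where `V` is the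
conjugate of `G`, and `P` into an idempotent `Q` with the same kernel as `V`. Consequently
`Q - t • Q * V* V` has spectral radius less than `1` for small `t > 0`. The spectral radius of
`diag(μ)^s * T * diag(μ)^(-s)` is log-convex in `s`, and inverse-closedness bounds it by the one of
`T` at `s = -1`; comparing `s = -1/2, 0, 1/2` carries the estimate back to `P - t • X`, and a
Neumann series inverts `X` on the range of `P`.
-/

noncomputable section

open scoped lp

/-! ## Group inverses in Banach algebras -/

section GroupInverse

open Metric

theorem map_circleIntegral {E F : Type*} [NormedAddCommGroup E] [NormedSpace ℂ E] [CompleteSpace E]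
    [NormedAddCommGroup F] [NormedSpace ℂ F] [CompleteSpace F] (L : E →L[ℂ] F) {f : ℂ → E} {c : ℂ}
    {r : ℝ} (hf : CircleIntegrable f c r) :
    L (∮ z in C(c, r), f z) = ∮ z in C(c, r), L (f z) := by
  simp only [circleIntegral, ← map_smul]
  exact (L.intervalIntegral_comp_comm hf.out).symm

theorem map_resolvent {𝕜 B C : Type*} [CommRing 𝕜] [Ring B] [Algebra 𝕜 B] [Ring C] [Algebra 𝕜 C]
    (φ : B →ₐ[𝕜] C) {g : B} {z : 𝕜} (hz : z ∈ resolventSet 𝕜 g) :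
    φ (resolvent g z) = resolvent (φ g) z := by
  have hφ : φ (algebraMap 𝕜 B z - g) = algebraMap 𝕜 C z - φ g := by rw [map_sub, φ.commutes]
  obtain ⟨u, hu⟩ := spectrum.mem_resolventSet_iff.1 hz
  rw [resolvent, resolvent, ← hφ, ← hu, Ring.inverse_unit]
  exact (Ring.inverse_unit (Units.map (φ : B →* C) u)).symm

/-- `b` is the group inverse of `a`: the two elements commute and are inverse to each other in the
corner ring of the idempotent `a * b`. -/
structure IsGroupInverse {R : Type*} [Mul R] (a b : R) : Prop where
  comm : a * b = b * a
  mul_mul_cancel_left : a * b * a = a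
  mul_mul_cancel_right : b * a * b = b

namespace IsGroupInverse

section Ring

variable {𝕜 R : Type*} [Field 𝕜] [Ring R] [Algebra 𝕜 R]

theorem exists_of_isUnit_one_sub {p x : R} (hp : IsIdempotentElem p) (hpx : p * x = x)
    (hxp : x * p = x) {t : 𝕜} (hunit : IsUnit (1 - (p - t • x))) :
    ∃ y, IsGroupInverse x y ∧ x * y = p := by
  obtain ⟨u, hu⟩ := hunit
  have hup : u * p = t • x := by simp [hu, sub_mul, hp.eq, hxp]
  have hpu : p * u = t • x := by simp [hu, mul_sub, hp.eq, hpx]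
  have hinv_p : ↑u⁻¹ * p = p * ↑u⁻¹ :=
    (Units.mul_left_inj u).1 (by simp [mul_assoc, hpu, ← hup])
  have hx : t • (x * (↑u⁻¹ * p)) = p := by
    rw [hinv_p, ← mul_assoc, hxp, ← smul_mul_assoc, ← hpu, Units.mul_inv_cancel_right]
  have hx' : t • (↑u⁻¹ * p * x) = p := by
    rw [mul_assoc, hpx, ← mul_smul_comm, ← hup, Units.inv_mul_cancel_left]
  refine ⟨t • (↑u⁻¹ * p), ⟨?_, ?_, ?_⟩, ?_⟩
  · rw [mul_smul_comm, smul_mul_assoc, hx, hx']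
  · rw [mul_smul_comm, hx, hpx]
  · rw [smul_mul_assoc, hx', mul_smul_comm, hinv_p, ← mul_assoc, hp.eq]
  · rw [mul_smul_comm, hx]

/-- In the corner of `a * b` the inverse of `z - a` is `-b (1 - z b)⁻¹`; in the complementary
corner, `a` vanishes. -/
theorem resolvent_eq {a b : R} (h : IsGroupInverse a b) {z : 𝕜} (hz : z ≠ 0)
    (hunit : IsUnit (1 - z • b)) :
    z ∈ resolventSet 𝕜 a ∧
      resolvent a z = z⁻¹ • (1 - a * b) - b * Ring.inverse (1 - z • b) := by
  obtain ⟨u, hu⟩ := hunit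
  have hab : Commute a b := h.comm
  have hau : Commute a ↑u⁻¹ :=
    (hu ▸ (Commute.one_right a).sub_right (hab.smul_right z) : Commute a ↑u).units_inv_right
  have hcorner : (z • 1 - a) * b = -(a * b * u) := by
    have hbab : b = a * b * b := by rw [h.comm, h.mul_mul_cancel_right]
    rw [hu, mul_sub, sub_mul, smul_one_mul, mul_one, mul_smul_comm, ← hbab, neg_sub]
  have hcorner' : (z • 1 - a) * (1 - a * b) = z • (1 - a * b) := by
    have haab : a * (a * b) = a := by rw [h.comm, ← mul_assoc, h.mul_mul_cancel_left]
    rw [sub_mul, mul_sub a, haab, mul_one, sub_self, sub_zero, smul_one_mul]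
  have hright : (z • 1 - a) * (z⁻¹ • (1 - a * b) - b * ↑u⁻¹) = 1 := by
    rw [mul_sub, mul_smul_comm, hcorner', inv_smul_smul₀ hz, ← mul_assoc, hcorner, neg_mul,
      Units.mul_inv_cancel_right, sub_neg_eq_add, sub_add_cancel]
  have hcomm : Commute a (z⁻¹ • (1 - a * b) - b * ↑u⁻¹) :=
    (((Commute.one_right a).sub_right ((Commute.refl a).mul_right hab)).smul_right _).sub_right
      (hab.mul_right hau)
  have hleft : (z⁻¹ • (1 - a * b) - b * ↑u⁻¹) * (z • 1 - a) = 1 := by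
    exact (((Commute.one_left _).smul_left z).sub_left hcomm).eq.symm.trans hright
  rw [← Algebra.algebraMap_eq_smul_one] at hright hleft
  let e : Rˣ := ⟨_, _, hright, hleft⟩
  refine ⟨spectrum.mem_resolventSet_iff.2 e.isUnit, ?_⟩
  rw [← hu, Ring.inverse_unit]
  exact Ring.inverse_unit e

end Ring

section BanachAlgebra

variable {B C : Type*} [NormedRing B] [NormedAlgebra ℂ B] [CompleteSpace B]
  [NormedRing C] [NormedAlgebra ℂ C] [CompleteSpace C]

theorem circleIntegral_inv_smul_resolvent {a b : C} (h : IsGroupInverse a b) {r : ℝ} (hr : 0 < r)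
    (hrb : r * ‖b‖ < 1) :
    ∮ z in C(0, r), z⁻¹ • resolvent a z = -((2 * Real.pi * Complex.I : ℂ) • b) := by
  have hunit : ∀ z ∈ closedBall (0 : ℂ) r, IsUnit (1 - z • b) := fun z hz => by
    refine isUnit_one_sub_of_norm_lt_one ((norm_smul_le _ _).trans_lt (lt_of_le_of_lt ?_ hrb))
    gcongr
    exact mem_closedBall_zero_iff.1 hz
  have hdiff : DiffContOnCl ℂ (fun z : ℂ => b * Ring.inverse (1 - z • b)) (ball 0 r) := by
    refine DifferentiableOn.diffContOnCl fun z hz => ?_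
    rw [closure_ball _ hr.ne'] at hz
    have hlin : DifferentiableWithinAt ℂ (fun z : ℂ => 1 - z • b) (closure (ball 0 r)) z := by
      fun_prop
    exact (hlin.inverse (hunit z hz)).const_mul b
  have hne : ∀ z ∈ sphere (0 : ℂ) r, z ≠ 0 := fun z hz => ne_of_mem_sphere hz hr.ne'
  have hsplit : Set.EqOn (fun z => z⁻¹ • resolvent a z) (fun z : ℂ =>
      (z - 0) ^ (-2 : ℤ) • (1 - a * b) - (z - 0)⁻¹ • (b * Ring.inverse (1 - z • b)))
      (sphere 0 r) := fun z hz => by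
    dsimp only
    rw [(h.resolvent_eq (hne z hz) (hunit z (sphere_subset_closedBall hz))).2, smul_sub, smul_smul,
      sub_zero, zpow_neg, zpow_two, mul_inv]
  have hint : CircleIntegrable (fun z : ℂ => (z - 0) ^ (-2 : ℤ) • (1 - a * b)) 0 r := by
    refine ContinuousOn.circleIntegrable hr.le fun z hz => ?_
    have := hne z hz
    exact ContinuousWithinAt.smul
      ((continuousWithinAt_id.sub continuousWithinAt_const).zpow₀ _ (by simpa)) (by fun_prop)
  have hint' : CircleIntegrable
      (fun z : ℂ => (z - 0)⁻¹ • (b * Ring.inverse (1 - z • b))) 0 r := by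
    refine ContinuousOn.circleIntegrable hr.le (ContinuousOn.smul ?_
      (hdiff.continuousOn_ball.mono sphere_subset_closedBall))
    exact ContinuousOn.inv₀ (by fun_prop) fun z hz => by simpa using hne z hz
  rw [circleIntegral.integral_congr hr.le hsplit, circleIntegral.integral_sub hint hint',
    circleIntegral.integral_smul_const, circleIntegral.integral_sub_zpow_of_ne (by decide),
    zero_smul, zero_sub, hdiff.circleIntegral_sub_inv_smul (mem_ball_self hr), zero_smul, sub_zero,
    Ring.inverse_one, mul_one]

theorem mem_range_of_isLocalHom (φ : B →A[ℂ] C) [IsLocalHom φ] {g : B} {b : C}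
    (h : IsGroupInverse (φ g) b) : b ∈ Set.range φ := by
  obtain ⟨r, hr, hrb⟩ : ∃ r : ℝ, 0 < r ∧ r * ‖b‖ < 1 :=
    ⟨(‖b‖ + 1)⁻¹, by positivity, by rw [inv_mul_lt_iff₀ (by positivity)]; linarith⟩
  have hmem : ∀ z ∈ sphere (0 : ℂ) r, z ∈ resolventSet ℂ g := fun z hz => by
    have hunit : IsUnit (1 - z • b) := by
      refine isUnit_one_sub_of_norm_lt_one ((norm_smul_le _ _).trans_lt ?_)
      rwa [mem_sphere_zero_iff_norm.1 hz]
    have hres := (h.resolvent_eq (ne_of_mem_sphere hz hr.ne') hunit).1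
    rw [spectrum.mem_resolventSet_iff, ← AlgHomClass.commutes φ, ← map_sub] at hres
    exact spectrum.mem_resolventSet_iff.2 hres.of_map
  have hint : CircleIntegrable (fun z => z⁻¹ • resolvent g z) 0 r := by
    refine ContinuousOn.circleIntegrable hr.le fun z hz => ?_
    exact ((continuousAt_inv₀ (ne_of_mem_sphere hz hr.ne')).smul
      (spectrum.hasDerivAt_resolvent_const_left (hmem z hz)).continuousAt).continuousWithinAt
  have hcontour : φ (∮ z in C(0, r), z⁻¹ • resolvent g z)
      = -((2 * Real.pi * Complex.I : ℂ) • b) := by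
    rw [← h.circleIntegral_inv_smul_resolvent hr hrb]
    refine (map_circleIntegral φ.toContinuousLinearMap hint).trans
      (circleIntegral.integral_congr hr.le fun z hz => ?_)
    exact (map_smul φ _ _).trans
      (congrArg (z⁻¹ • ·) (map_resolvent (φ : B →ₐ[ℂ] C) (hmem z hz)))
  refine ⟨(2 * Real.pi * Complex.I : ℂ)⁻¹ • -∮ z in C(0, r), z⁻¹ • resolvent g z, ?_⟩
  rw [map_smul, map_neg, hcontour, neg_neg, inv_smul_smul₀ Complex.two_pi_I_ne_zero]

end BanachAlgebra

end IsGroupInverse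

end GroupInverse

/-! ## Spectral radii and automatic continuity -/

section SpectralRadius

open Filter Topology

section Ring

variable {𝕜 B C : Type*} [NormedField 𝕜] [Ring B] [Algebra 𝕜 B] [Ring C] [Algebra 𝕜 C]

theorem spectralRadius_mul_comm (a b : B) :
    spectralRadius 𝕜 (a * b) = spectralRadius 𝕜 (b * a) := by
  have hle : ∀ a b : B, spectralRadius 𝕜 (a * b) ≤ spectralRadius 𝕜 (b * a) := fun a b => by
    refine iSup₂_le fun z hz => ?_
    rcases eq_or_ne z 0 with rfl | hz0
    · simp
    · have hz' : z ∈ spectrum 𝕜 (a * b) \ {0} := ⟨hz, hz0⟩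
      rw [spectrum.nonzero_mul_comm] at hz'
      exact le_iSup₂ (f := fun (z : 𝕜) (_ : z ∈ spectrum 𝕜 (b * a)) => (‖z‖₊ : ℝ≥0∞)) z hz'.1
  exact le_antisymm (hle a b) (hle b a)

theorem spectralRadius_map_le (φ : B →ₐ[𝕜] C) (a : B) :
    spectralRadius 𝕜 (φ a) ≤ spectralRadius 𝕜 a :=
  iSup_le_iSup_of_subset (AlgHom.spectrum_apply_subset φ a)

theorem spectralRadius_le_map_of_isLocalHom (φ : B →ₐ[𝕜] C) [IsLocalHom φ] (a : B) :
    spectralRadius 𝕜 a ≤ spectralRadius 𝕜 (φ a) := by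
  refine iSup_le_iSup_of_subset fun z hz hz' => hz ?_
  rw [spectrum.mem_resolventSet_iff, ← AlgHom.commutes φ z, ← map_sub] at hz'
  exact hz'.of_map

theorem isUnit_one_sub_of_spectralRadius_lt_one {a : B} (ha : spectralRadius 𝕜 a < 1) :
    IsUnit (1 - a) := by
  simpa [spectrum.mem_resolventSet_iff] using
    spectrum.mem_resolventSet_of_spectralRadius_lt (𝕜 := 𝕜) (a := a) (k := 1) (by simpa using ha)

end Ring

theorem spectralRadius_le_nnnorm_mul_nnnorm_one {𝕜 B : Type*} [NontriviallyNormedField 𝕜]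
    [NormedRing B] [NormedAlgebra 𝕜 B] [CompleteSpace B] (a : B) :
    spectralRadius 𝕜 a ≤ ‖a‖₊ * ‖(1 : B)‖₊ := by
  simpa using spectrum.spectralRadius_le_pow_nnnorm_pow_one_div 𝕜 a 0

section BanachAlgebra

variable {B : Type*} [NormedRing B] [NormedAlgebra ℂ B] [CompleteSpace B]

theorem spectralRadius_ne_top (a : B) : spectralRadius ℂ a ≠ ∞ :=
  ne_top_of_le_ne_top (by finiteness) (spectralRadius_le_nnnorm_mul_nnnorm_one a)

theorem spectralRadius_sq_le_mul {a b c : B} (h : ∀ n, ‖c ^ n‖ ^ 2 ≤ ‖a ^ n‖ * ‖b ^ n‖) :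
    spectralRadius ℂ c ^ 2 ≤ spectralRadius ℂ a * spectralRadius ℂ b := by
  have hlim := spectrum.pow_nnnorm_pow_one_div_tendsto_nhds_spectralRadius (A := B)
  refine le_of_tendsto_of_tendsto' ((ENNReal.continuous_pow 2).tendsto _ |>.comp (hlim c))
    (ENNReal.Tendsto.mul (hlim a) (.inr (spectralRadius_ne_top b)) (hlim b)
      (.inr (spectralRadius_ne_top a))) fun n => ?_
  have hn : (‖c ^ n‖₊ : ℝ≥0∞) ^ 2 ≤ ‖a ^ n‖₊ * ‖b ^ n‖₊ := by exact_mod_cast h n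
  calc ((‖c ^ n‖₊ : ℝ≥0∞) ^ (1 / n : ℝ)) ^ 2 = ((‖c ^ n‖₊ : ℝ≥0∞) ^ 2) ^ (1 / n : ℝ) := by
        simp only [← ENNReal.rpow_natCast, ← ENNReal.rpow_mul, mul_comm]
    _ ≤ (‖a ^ n‖₊ * ‖b ^ n‖₊ : ℝ≥0∞) ^ (1 / n : ℝ) := by gcongr
    _ = _ := ENNReal.mul_rpow_of_nonneg _ _ (by positivity)

end BanachAlgebra

section CStar

variable {B C : Type*} [NormedRing B] [NormedAlgebra ℂ B] [CompleteSpace B] [StarRing B]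
  [CStarAlgebra C]

theorem norm_sq_starAlgHom_apply_le (φ : B →⋆ₐ[ℂ] C) (b : B) :
    ‖φ b‖ ^ 2 ≤ ‖star b‖ * ‖b‖ * ‖(1 : B)‖ := by
  have hrad : (‖φ (star b * b)‖₊ : ℝ≥0∞) ≤ ‖star b * b‖₊ * ‖(1 : B)‖₊ := by
    rw [← ((IsSelfAdjoint.star_mul_self b).map φ).spectralRadius_eq_nnnorm]
    exact (spectralRadius_map_le φ.toAlgHom _).trans (spectralRadius_le_nnnorm_mul_nnnorm_one _)
  calc ‖φ b‖ ^ 2 = ‖φ (star b * b)‖ := by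
        rw [map_mul, map_star, CStarRing.norm_star_mul_self, pow_two]
    _ ≤ ‖star b * b‖ * ‖(1 : B)‖ := by exact_mod_cast hrad
    _ ≤ ‖star b‖ * ‖b‖ * ‖(1 : B)‖ := by gcongr; exact norm_mul_le _ _

theorem tendsto_starAlgHom_apply_zero (φ : B →⋆ₐ[ℂ] C) {b : ℕ → B} {c : B}
    (hb : Tendsto b atTop (𝓝 0)) (hc : Tendsto (fun n => star (b n)) atTop (𝓝 c)) :
    Tendsto (fun n => φ (b n)) atTop (𝓝 0) := by
  have hbound : Tendsto (fun n => ‖star (b n)‖ * ‖b n‖ * ‖(1 : B)‖) atTop (𝓝 0) := by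
    simpa using (hc.norm.mul hb.norm).mul_const ‖(1 : B)‖
  have hsq : Tendsto (fun n => ‖φ (b n)‖ ^ 2) atTop (𝓝 0) :=
    squeeze_zero (fun n => sq_nonneg _) (fun n => norm_sq_starAlgHom_apply_le φ (b n)) hbound
  exact tendsto_zero_iff_norm_tendsto_zero.2 (by simpa using hsq.sqrt)

variable [StarModule ℂ B]

theorem continuous_star_of_injective_starAlgHom {φ : B →⋆ₐ[ℂ] C} (hφ : Function.Injective φ) :
    Continuous (star : B → B) := by
  let starLin : B →ₗ[ℝ] B :=
    { toFun := star, map_add' := star_add, map_smul' := fun r b => by simp [star_smul] }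
  refine starLin.continuous_of_seq_closed_graph fun u x y hu hy => ?_
  have hx : Tendsto (fun n => u n - x) atTop (𝓝 0) := tendsto_sub_nhds_zero_iff.2 hu
  have hy' : Tendsto (fun n => star (u n - x)) atTop (𝓝 (y - star x)) :=
    (hy.sub_const (star x)).congr fun n => (star_sub (u n) x).symm
  have hφstar : Tendsto (fun n => φ (star (u n - x))) atTop (𝓝 0) := by
    simpa only [map_star, star_zero] using (tendsto_starAlgHom_apply_zero φ hx hy').star
  have hφdiff : Tendsto (fun n => φ (star (u n - x) - (y - star x))) atTop (𝓝 0) :=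
    tendsto_starAlgHom_apply_zero φ (tendsto_sub_nhds_zero_iff.2 hy')
      (by simpa only [star_sub, star_star] using hx.sub_const (star (y - star x)))
  have hφy : φ (y - star x) = 0 := by
    simp only [map_sub φ (star _)] at hφdiff
    exact tendsto_nhds_unique (tendsto_sub_nhds_zero_iff.1 hφdiff) hφstar |>.symm ▸ rfl
  exact sub_eq_zero.1 (hφ (hφy.trans (map_zero φ).symm))

theorem continuous_starAlgHom_of_injective {φ : B →⋆ₐ[ℂ] C} (hφ : Function.Injective φ) :
    Continuous φ := by
  refine continuous_of_continuousAt_zero φ (tendsto_iff_seq_tendsto.2 fun b hb => ?_)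
  rw [map_zero]
  exact tendsto_starAlgHom_apply_zero φ hb
    (((continuous_star_of_injective_starAlgHom hφ).tendsto 0).comp hb)

end CStar

section Hilbert

variable {𝕜 E F : Type*} [RCLike 𝕜] [NormedAddCommGroup E] [InnerProductSpace 𝕜 E] [CompleteSpace E]
  [NormedAddCommGroup F] [InnerProductSpace 𝕜 F] [CompleteSpace F]

theorem norm_sq_sub_smul_adjoint_comp_le (V : E →L[𝕜] F) {t c : ℝ} (ht : 0 ≤ t)
    (htV : t * ‖V‖ ^ 2 ≤ 1) {y : E} (hc : c * ‖y‖ ^ 2 ≤ ‖V y‖ ^ 2) :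
    ‖y - (t : 𝕜) • V.adjoint (V y)‖ ^ 2 ≤ (1 - t * c) * ‖y‖ ^ 2 := by
  have hre : RCLike.re ⟪y, (t : 𝕜) • V.adjoint (V y)⟫_𝕜 = t * ‖V y‖ ^ 2 := by
    rw [inner_smul_right, ContinuousLinearMap.adjoint_inner_right, inner_self_eq_norm_sq_to_K]
    norm_cast
  have hadj : ‖V.adjoint (V y)‖ ^ 2 ≤ ‖V‖ ^ 2 * ‖V y‖ ^ 2 := by
    rw [← mul_pow, ← LinearIsometryEquiv.norm_map ContinuousLinearMap.adjoint V]
    gcongr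
    exact V.adjoint.le_opNorm _
  have hsmul : ‖(t : 𝕜) • V.adjoint (V y)‖ ^ 2 ≤ t * ‖V y‖ ^ 2 := by
    rw [norm_smul, RCLike.norm_of_nonneg ht]
    calc (t * ‖V.adjoint (V y)‖) ^ 2 ≤ t ^ 2 * (‖V‖ ^ 2 * ‖V y‖ ^ 2) := by rw [mul_pow]; gcongr
      _ = t * (t * ‖V‖ ^ 2) * ‖V y‖ ^ 2 := by ring
      _ ≤ t * 1 * ‖V y‖ ^ 2 := by gcongr
      _ = t * ‖V y‖ ^ 2 := by rw [mul_one]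
  rw [@norm_sub_sq 𝕜, hre]
  linarith [mul_le_mul_of_nonneg_left hc ht]

theorem mul_starProjection_orthogonal_ker (V : E →L[𝕜] E) :
    V * V.kerᗮ.starProjection = V := by
  rw [Submodule.starProjection_orthogonal', mul_sub, mul_one, sub_eq_self]
  exact ContinuousLinearMap.ext fun x => LinearMap.mem_ker.1 (V.ker.starProjection_apply_mem x)

theorem starProjection_orthogonal_ker_mul {V T : E →L[𝕜] E} (h : V * T = V) :
    V.kerᗮ.starProjection * T = V.kerᗮ.starProjection := by
  refine ContinuousLinearMap.ext fun x => sub_eq_zero.1 ?_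
  have hker : T x - x ∈ V.ker := by
    rw [LinearMap.mem_ker, ContinuousLinearMap.coe_coe, map_sub, sub_eq_zero]
    exact congrArg (· x) h
  rw [mul_apply_eq_comp, ← map_sub]
  exact Submodule.starProjection_orthogonal_apply_eq_zero hker

theorem norm_starProjection_orthogonal_ker_le {V J : E →L[𝕜] E} (h : V * J * V = V) (x : E) :
    ‖V.kerᗮ.starProjection x‖ ≤ ‖J‖ * ‖V x‖ := by
  have hRJV := starProjection_orthogonal_ker_mul ((mul_assoc V J V).symm.trans h)
  calc ‖V.kerᗮ.starProjection x‖ = ‖V.kerᗮ.starProjection (J (V x))‖ := by nth_rw 1 [← hRJV]; rfl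
    _ ≤ ‖J (V x)‖ := V.kerᗮ.norm_starProjection_apply_le _
    _ ≤ ‖J‖ * ‖V x‖ := J.le_opNorm _

theorem exists_norm_starProjection_sub_lt_one {V J : E →L[𝕜] E} (h : V * J * V = V) :
    ∃ t : ℝ, 0 < t ∧ ‖V.kerᗮ.starProjection - (t : 𝕜) • (V.adjoint * V)‖ < 1 := by
  set R := V.kerᗮ.starProjection
  have hVR (x : E) : V (R x) = V x := congrArg (· x) (mul_starProjection_orthogonal_ker V)
  set t : ℝ := (‖V‖ ^ 2 + 1)⁻¹ with ht
  set c : ℝ := (‖J‖ ^ 2 + 1)⁻¹ with hc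
  have htc : 0 < t * c := by positivity
  have htc1 : t * c ≤ 1 := mul_le_one₀ (inv_le_one_of_one_le₀ (by linarith [sq_nonneg ‖V‖]))
    (by positivity) (inv_le_one_of_one_le₀ (by linarith [sq_nonneg ‖J‖]))
  have htV : t * ‖V‖ ^ 2 ≤ 1 := by rw [ht, inv_mul_le_iff₀ (by positivity)]; linarith
  have hlower (x : E) : c * ‖R x‖ ^ 2 ≤ ‖V (R x)‖ ^ 2 := by
    rw [hc, hVR, inv_mul_le_iff₀ (by positivity)]
    nlinarith [pow_le_pow_left₀ (norm_nonneg _) (norm_starProjection_orthogonal_ker_le h x) 2]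
  have hbound (x : E) : ‖(R - (t : 𝕜) • (V.adjoint * V)) x‖ ≤ √(1 - t * c) * ‖x‖ := by
    rw [← Real.sqrt_sq (norm_nonneg x), ← Real.sqrt_mul' _ (sq_nonneg _)]
    refine Real.le_sqrt_of_sq_le ?_
    calc ‖(R - (t : 𝕜) • (V.adjoint * V)) x‖ ^ 2
        = ‖R x - (t : 𝕜) • V.adjoint (V (R x))‖ ^ 2 := by rw [hVR]; rfl
      _ ≤ (1 - t * c) * ‖R x‖ ^ 2 :=
          norm_sq_sub_smul_adjoint_comp_le V (by positivity) htV (hlower x)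
      _ ≤ (1 - t * c) * ‖x‖ ^ 2 := by
          gcongr
          exact V.kerᗮ.norm_starProjection_apply_le x
  refine ⟨t, by positivity,
    (ContinuousLinearMap.opNorm_le_bound _ (Real.sqrt_nonneg _) hbound).trans_lt ?_⟩
  rw [Real.sqrt_lt' one_pos]
  linarith

/-- The orthogonal projection onto `(ker V)ᗮ` may replace the oblique projection `J * V` along
`ker V`, because the spectral radius of a product does not depend on the order of its factors. -/
theorem exists_spectralRadius_sub_smul_adjoint_mul_lt_one {V J : E →L[𝕜] E} (h : V * J * V = V) :
    ∃ t : ℝ, 0 < t ∧ spectralRadius 𝕜 (J * V - (t : 𝕜) • (J * V * (V.adjoint * V))) < 1 := by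
  obtain ⟨t, ht, hlt⟩ := exists_norm_starProjection_sub_lt_one h
  refine ⟨t, ht, ?_⟩
  set R := V.kerᗮ.starProjection
  have hVR : V * R = V := mul_starProjection_orthogonal_ker V
  have hRJV : R * (J * V) = R :=
    starProjection_orthogonal_ker_mul ((mul_assoc V J V).symm.trans h)
  have hleft : J * V * (R - (t : 𝕜) • (V.adjoint * V))
      = J * V - (t : 𝕜) • (J * V * (V.adjoint * V)) := by
    rw [mul_sub, mul_assoc J V R, hVR, mul_smul_comm]
  have hright : (R - (t : 𝕜) • (V.adjoint * V)) * (J * V) = R - (t : 𝕜) • (V.adjoint * V) := by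
    rw [sub_mul, hRJV, smul_mul_assoc, mul_assoc, ← mul_assoc V J V, h]
  rw [← hleft, spectralRadius_mul_comm, hright]
  refine (spectralRadius_le_nnnorm_mul_nnnorm_one _).trans_lt ?_
  have hone : ‖(1 : E →L[𝕜] E)‖ ≤ 1 := ContinuousLinearMap.norm_id_le
  exact_mod_cast (mul_le_of_le_one_right (norm_nonneg _) hone).trans_lt hlt

end Hilbert

end SpectralRadius

/-! ## Weights and diagonal conjugation -/

namespace PosWeight

variable {K : Type u}

theorem ext {m w : PosWeight K} (h : ∀ k, m k = w k) : m = w := by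
  cases m
  cases w
  congr
  exact funext h

theorem inv_apply (m : PosWeight K) (k : K) : m⁻¹ k = (m k)⁻¹ := rfl

theorem mul_apply (m w : PosWeight K) (k : K) : (m * w) k = m k * w k := rfl

theorem div_apply (m w : PosWeight K) (k : K) : (m / w) k = m k / w k := rfl

theorem ofReal_ne_zero (m : PosWeight K) (k : K) : (m k : ℂ) ≠ 0 :=
  Complex.ofReal_ne_zero.2 (m.pos k).ne'

instance : CommGroup (PosWeight K) where
  mul_assoc a b c := ext fun k => mul_assoc (a k) (b k) (c k)
  one_mul a := ext fun k => one_mul (a k)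
  mul_one a := ext fun k => mul_one (a k)
  mul_comm a b := ext fun k => mul_comm (a k) (b k)
  inv_mul_cancel a := ext fun k => inv_mul_cancel₀ (a.pos k).ne'
  div_eq_mul_inv a b := ext fun k => div_eq_mul_inv (a k) (b k)

theorem sqrt_mul_sqrt (m : PosWeight K) : m.sqrt * m.sqrt = m :=
  ext fun k => Real.mul_self_sqrt (m.pos k).le

theorem sqrt_inv (m : PosWeight K) : m⁻¹.sqrt = m.sqrt⁻¹ :=
  ext fun k => Real.sqrt_inv (m k)

end PosWeight

section OpMatrix

variable {K : Type u}

open scoped Classical in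
/-- The canonical unit vector `e_k` of `ℓ²(K)`. -/
def unitVec (k : K) : ℓ²(K, ℂ) := lp.single 2 k 1

theorem opMatrix_apply (T : ℓ²(K, ℂ) →L[ℂ] ℓ²(K, ℂ)) (k l : K) :
    opMatrix T k l = T (unitVec l) k := rfl

open scoped Classical in
theorem unitVec_apply (k l : K) : unitVec k l = if l = k then 1 else 0 := by
  simp [unitVec, Pi.single_apply]

theorem inner_unitVec_left (k : K) (x : ℓ²(K, ℂ)) : ⟪unitVec k, x⟫_ℂ = x k := by
  classical
  simpa [unitVec] using lp.inner_single_left (𝕜 := ℂ) k (1 : ℂ) x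

theorem hasSum_unitVec (x : ℓ²(K, ℂ)) : HasSum (fun k => x k • unitVec k) x := by
  classical
  convert lp.hasSum_single (p := 2) (by norm_num) x using 2 with k
  ext j
  simp [unitVec_apply, Pi.single_apply]

theorem hasSum_opMatrix_mul (T : ℓ²(K, ℂ) →L[ℂ] ℓ²(K, ℂ)) (x : ℓ²(K, ℂ)) (k : K) :
    HasSum (fun l => opMatrix T k l * x l) (T x k) := by
  simpa [opMatrix_apply, lp.evalCLM, mul_comm] using
    ((hasSum_unitVec x).mapL T).mapL (lp.evalCLM ℂ (fun _ : K => ℂ) 2 k)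

theorem opMatrix_injective : Function.Injective (opMatrix (K := K)) := fun S T h =>
  ContinuousLinearMap.ext fun x => lp.ext <| funext fun k =>
    (hasSum_opMatrix_mul S x k).unique (h ▸ hasSum_opMatrix_mul T x k)

theorem hasSum_opMatrix_comp (S T : ℓ²(K, ℂ) →L[ℂ] ℓ²(K, ℂ)) (k l : K) :
    HasSum (fun j => opMatrix S k j * opMatrix T j l) (opMatrix (S * T) k l) :=
  hasSum_opMatrix_mul S (T (unitVec l)) k

theorem opMatrix_adjoint (T : ℓ²(K, ℂ) →L[ℂ] ℓ²(K, ℂ)) (k l : K) :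
    opMatrix T.adjoint k l = conj (opMatrix T l k) := by
  rw [opMatrix_apply, opMatrix_apply, ← inner_unitVec_left, ← inner_unitVec_left,
    ContinuousLinearMap.adjoint_inner_right, inner_conj_symm]

open scoped Classical in
theorem opMatrix_one (k l : K) :
    opMatrix (1 : ℓ²(K, ℂ) →L[ℂ] ℓ²(K, ℂ)) k l = if k = l then 1 else 0 :=
  unitVec_apply l k

end OpMatrix

/-- `T'` is the operator `diag(w) T diag(1/w)`, where boundedness of the latter is part of the
assertion. -/
def IsWeightConj {K : Type u} (w : PosWeight K) (T T' : ℓ²(K, ℂ) →L[ℂ] ℓ²(K, ℂ)) : Prop :=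
  opMatrix T' = conjDiag w (opMatrix T)

namespace IsWeightConj

variable {K : Type u} {w w' : PosWeight K} {R S S' T T' : ℓ²(K, ℂ) →L[ℂ] ℓ²(K, ℂ)}

theorem opMatrix_apply (h : IsWeightConj w T T') (k l : K) :
    opMatrix T' k l = w k * opMatrix T k l * (w l : ℂ)⁻¹ := by
  rw [h, conjDiag, Complex.ofReal_inv]

theorem of_opMatrix_apply (h : ∀ k l, opMatrix T' k l = w k * opMatrix T k l * (w l : ℂ)⁻¹) :
    IsWeightConj w T T' := by
  ext k l
  rw [h, conjDiag, Complex.ofReal_inv]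

theorem unique (h : IsWeightConj w T S) (h' : IsWeightConj w T T') : S = T' :=
  opMatrix_injective (h.trans h'.symm)

theorem sub (h : IsWeightConj w S S') (h' : IsWeightConj w T T') :
    IsWeightConj w (S - T) (S' - T') :=
  .of_opMatrix_apply fun k l => by
    change opMatrix S' k l - opMatrix T' k l = w k * (opMatrix S k l - opMatrix T k l) * _
    rw [h.opMatrix_apply, h'.opMatrix_apply]
    ring

theorem smul (h : IsWeightConj w T T') (a : ℂ) : IsWeightConj w (a • T) (a • T') :=
  .of_opMatrix_apply fun k l => by
    change a * opMatrix T' k l = w k * (a * opMatrix T k l) * _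
    rw [h.opMatrix_apply]
    ring

protected theorem one : IsWeightConj w 1 1 := .of_opMatrix_apply fun k l => by
  rw [opMatrix_one]
  split_ifs with hkl
  · rw [← hkl, mul_one, mul_inv_cancel₀ (w.ofReal_ne_zero k)]
  · simp

theorem mul (h : IsWeightConj w S S') (h' : IsWeightConj w T T') :
    IsWeightConj w (S * T) (S' * T') := .of_opMatrix_apply fun k l => by
  have hterm : ∀ j, opMatrix S' k j * opMatrix T' j l
      = w k * (opMatrix S k j * opMatrix T j l) * (w l : ℂ)⁻¹ := fun j => by
    have := w.ofReal_ne_zero j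
    rw [h.opMatrix_apply, h'.opMatrix_apply]
    field_simp
  refine (hasSum_opMatrix_comp S' T' k l).unique ?_
  simpa only [hterm] using ((hasSum_opMatrix_comp S T k l).mul_left _).mul_right _

theorem pow (h : IsWeightConj w T T') (n : ℕ) : IsWeightConj w (T ^ n) (T' ^ n) := by
  induction n with
  | zero => simpa using IsWeightConj.one
  | succ n ih => rw [pow_succ, pow_succ]; exact ih.mul h

protected theorem trans (h : IsWeightConj w R S) (h' : IsWeightConj w' S T) :
    IsWeightConj (w' * w) R T := .of_opMatrix_apply fun k l => by
  rw [h'.opMatrix_apply, h.opMatrix_apply, PosWeight.mul_apply, PosWeight.mul_apply]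
  push_cast
  ring

protected theorem symm (h : IsWeightConj w T T') : IsWeightConj w⁻¹ T' T :=
  .of_opMatrix_apply fun k l => by
    have := w.ofReal_ne_zero k
    have := w.ofReal_ne_zero l
    rw [h.opMatrix_apply, PosWeight.inv_apply, PosWeight.inv_apply]
    push_cast
    field_simp

theorem adjoint (h : IsWeightConj w T T') : IsWeightConj w T'.adjoint T.adjoint :=
  .of_opMatrix_apply fun k l => by
    have := w.ofReal_ne_zero k
    have := w.ofReal_ne_zero l
    rw [opMatrix_adjoint, opMatrix_adjoint, h.opMatrix_apply]
    simp only [map_mul, map_inv₀, Complex.conj_ofReal]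
    field_simp

end IsWeightConj

/-! ## Interpolation of weighted conjugates -/

section Interpolation

variable {K : Type u}

/-- The diagonal operator on `ℓ²(K)` with entries `a k` for `k ∈ F` and `0` elsewhere; it is used
to truncate operators to finite sections. -/
def finDiag (F : Finset K) (a : K → ℝ) : ℓ²(K, ℂ) →L[ℂ] ℓ²(K, ℂ) :=
  ∑ k ∈ F, (lp.evalCLM ℂ (fun _ : K => ℂ) 2 k).smulRight ((a k : ℂ) • unitVec k)

open scoped Classical in
theorem finDiag_apply (F : Finset K) (a : K → ℝ) (x : ℓ²(K, ℂ)) (k : K) :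
    finDiag F a x k = if k ∈ F then (a k : ℂ) * x k else 0 := by
  rw [← inner_unitVec_left]
  simp [finDiag, sum_apply, inner_unitVec_left, unitVec_apply, lp.evalCLM, mul_comm,
    -Complex.coe_smul]

open scoped Classical in
theorem finDiag_unitVec (F : Finset K) (a : K → ℝ) (l : K) :
    finDiag F a (unitVec l) = if l ∈ F then (a l : ℂ) • unitVec l else 0 := by
  ext k
  rcases eq_or_ne k l with rfl | hkl
  · by_cases hk : k ∈ F <;> simp [finDiag_apply, hk, -Complex.coe_smul]
  · by_cases hl : l ∈ F <;>
      simp [finDiag_apply, unitVec_apply, hl, hkl, -Complex.coe_smul]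

theorem finDiag_mul (F : Finset K) (a b : K → ℝ) :
    finDiag F a * finDiag F b = finDiag F (a * b) := by
  ext x k
  simp only [mul_apply_eq_comp, finDiag_apply]
  split_ifs <;> simp [mul_assoc]

open scoped Classical in
theorem opMatrix_finDiag_mul_mul (F : Finset K) (a b : K → ℝ) (T : ℓ²(K, ℂ) →L[ℂ] ℓ²(K, ℂ))
    (k l : K) : opMatrix (finDiag F a * T * finDiag F b) k l
      = if k ∈ F ∧ l ∈ F then a k * opMatrix T k l * b l else 0 := by
  by_cases hk : k ∈ F <;> by_cases hl : l ∈ F <;>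
    simp [opMatrix_apply, mul_apply_eq_comp, finDiag_unitVec, finDiag_apply, hk, hl]
  ring

theorem isSelfAdjoint_finDiag (F : Finset K) (a : K → ℝ) : IsSelfAdjoint (finDiag F a) := by
  refine opMatrix_injective (Matrix.ext fun k l => ?_)
  rw [ContinuousLinearMap.star_eq_adjoint, opMatrix_adjoint]
  rcases eq_or_ne k l with rfl | hkl
  · by_cases hk : k ∈ F <;>
      simp [opMatrix_apply, finDiag_unitVec, hk, unitVec_apply, -Complex.coe_smul]
  · simp [opMatrix_apply, finDiag_apply, unitVec_apply, hkl, hkl.symm]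

theorem isStarProjection_finDiag_one (F : Finset K) : IsStarProjection (finDiag F 1) :=
  ⟨(finDiag_mul F 1 1).trans (by rw [one_mul]), isSelfAdjoint_finDiag F 1⟩

/-- `c` bounds all finite sections of the matrix `M` in the operator norm of `ℓ²(K)`. The sections
are only required to extend to operators on `ℓ²(K)`, so that no embedding of finite matrices is
needed. -/
def FiniteSectionBound (M : Matrix K K ℂ) (c : ℝ) : Prop :=
  ∀ F : Finset K, ∃ T : ℓ²(K, ℂ) →L[ℂ] ℓ²(K, ℂ), ‖T‖ ≤ c ∧ ∀ k ∈ F, ∀ l ∈ F, opMatrix T k l = M k l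

namespace FiniteSectionBound

variable {M : Matrix K K ℂ} {c : ℝ}

theorem sum_norm_rpow_le (h : FiniteSectionBound M c) (x : K →₀ ℂ) (s : Finset K) :
    ∑ k ∈ s, ‖x.sum fun l a => a * M k l‖ ^ (2 : ℝ≥0∞).toReal
      ≤ (c * ‖Finsupp.linearCombination ℂ unitVec x‖) ^ (2 : ℝ≥0∞).toReal := by
  classical
  obtain ⟨T, hT, hTM⟩ := h (x.support ∪ s)
  set y := Finsupp.linearCombination ℂ unitVec x with hy
  have hTy : ∀ k ∈ s, T y k = x.sum fun l a => a * M k l := fun k hk => by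
    rw [hy, Finsupp.linearCombination_apply, map_finsuppSum, ← inner_unitVec_left, Finsupp.sum,
      inner_sum]
    refine Finset.sum_congr rfl fun l hl => ?_
    rw [map_smul, inner_smul_right, inner_unitVec_left, ← opMatrix_apply,
      hTM k (Finset.mem_union_right _ hk) l (Finset.mem_union_left _ hl)]
  calc ∑ k ∈ s, ‖x.sum fun l a => a * M k l‖ ^ (2 : ℝ≥0∞).toReal
      = ∑ k ∈ s, ‖T y k‖ ^ (2 : ℝ≥0∞).toReal :=
        Finset.sum_congr rfl fun k hk => by rw [hTy k hk]
    _ ≤ ‖T y‖ ^ (2 : ℝ≥0∞).toReal := lp.sum_rpow_le_norm_rpow (by norm_num) _ s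
    _ ≤ (c * ‖y‖) ^ (2 : ℝ≥0∞).toReal := by
        gcongr
        exact T.le_of_opNorm_le hT _

theorem memℓp_column (h : FiniteSectionBound M c) (l : K) : Memℓp (fun k => M k l) 2 :=
  memℓp_gen' fun s => by simpa using h.sum_norm_rpow_le (Finsupp.single l 1) s

/-- The `l`-th column of `M` as an element of `ℓ²(K)`. -/
def column (h : FiniteSectionBound M c) (l : K) : ℓ²(K, ℂ) := ⟨fun k => M k l, h.memℓp_column l⟩

theorem nonneg (h : FiniteSectionBound M c) : 0 ≤ c :=
  have ⟨_, hT, _⟩ := h ∅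
  (norm_nonneg _).trans hT

theorem norm_linearCombination_column_le (h : FiniteSectionBound M c) (x : K →₀ ℂ) :
    ‖Finsupp.linearCombination ℂ h.column x‖ ≤ c * ‖Finsupp.linearCombination ℂ unitVec x‖ := by
  have := h.nonneg
  refine lp.norm_le_of_forall_sum_le (p := 2) (by norm_num) (by positivity) fun s => ?_
  have hentry : ∀ k, Finsupp.linearCombination ℂ h.column x k = x.sum fun l a => a * M k l := by
    intro k
    rw [← inner_unitVec_left, Finsupp.linearCombination_apply, Finsupp.sum, inner_sum]
    exact Finset.sum_congr rfl fun l _ => by rw [inner_smul_right, inner_unitVec_left]; rfl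
  simpa only [hentry] using h.sum_norm_rpow_le x s

theorem exists_opMatrix_eq (h : FiniteSectionBound M c) :
    ∃ V : ℓ²(K, ℂ) →L[ℂ] ℓ²(K, ℂ), opMatrix V = M ∧ ‖V‖ ≤ c := by
  let f : (K →₀ ℂ) →ₗ[ℂ] ℓ²(K, ℂ) := Finsupp.linearCombination ℂ h.column
  let e : (K →₀ ℂ) →ₗ[ℂ] ℓ²(K, ℂ) := Finsupp.linearCombination ℂ unitVec
  have hdense : DenseRange e := fun x =>
    mem_closure_of_tendsto (hasSum_unitVec x) <| .of_forall fun s =>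
      ⟨∑ k ∈ s, Finsupp.single k (x k), by simp [e]⟩
  have hnorm : ∀ x, ‖f x‖ ≤ c * ‖e x‖ := h.norm_linearCombination_column_le
  refine ⟨f.extendOfNorm e, ?_, LinearMap.opNorm_extendOfNorm_le hdense h.nonneg hnorm⟩
  ext k l
  have hcol : f.extendOfNorm e (unitVec l) = h.column l := by
    simpa [e, f] using LinearMap.extendOfNorm_eq hdense ⟨c, hnorm⟩ (Finsupp.single l 1)
  rw [opMatrix_apply, hcol]
  rfl

end FiniteSectionBound

namespace IsWeightConj

variable {w : PosWeight K} {T T' V : ℓ²(K, ℂ) →L[ℂ] ℓ²(K, ℂ)}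

theorem finDiag_mul_mul (h : IsWeightConj w T T') (F : Finset K) :
    finDiag F w.sqrt * finDiag F w.sqrt * T * (finDiag F w⁻¹.sqrt * finDiag F w⁻¹.sqrt)
      = finDiag F 1 * T' * finDiag F 1 := by
  have hsqrt : ∀ m : PosWeight K, (m.sqrt * m.sqrt : K → ℝ) = m := fun m =>
    congrArg PosWeight.val m.sqrt_mul_sqrt
  refine opMatrix_injective (Matrix.ext fun k l => ?_)
  rw [finDiag_mul, finDiag_mul, hsqrt, hsqrt, opMatrix_finDiag_mul_mul, opMatrix_finDiag_mul_mul,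
    h.opMatrix_apply, PosWeight.inv_apply]
  simp

theorem norm_sq_finDiag_sqrt_mul_mul_le (h : IsWeightConj w T T') (F : Finset K) :
    ‖finDiag F w.sqrt * T * finDiag F w⁻¹.sqrt‖ ^ 2 ≤ ‖T‖ * ‖T'‖ := by
  set d := finDiag F w.sqrt
  set d' := finDiag F w⁻¹.sqrt
  set E := finDiag F 1
  have hd : star d = d := isSelfAdjoint_finDiag F w.sqrt
  have hd' : star d' = d' := isSelfAdjoint_finDiag F w⁻¹.sqrt
  have hE : ‖E‖ ≤ 1 := (isStarProjection_finDiag_one F).norm_le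
  have hconj : d * d * T * (d' * d') = E * T' * E := h.finDiag_mul_mul F
  -- The spectral radius is invariant under cyclic permutation, so the last `d'` can be moved to
  -- the other one.
  have hrad : spectralRadius ℂ (star (d * T * d') * (d * T * d'))
      = spectralRadius ℂ (star T * (E * T' * E)) := by
    rw [← hconj, star_mul, star_mul, hd, hd', mul_assoc, spectralRadius_mul_comm]
    simp only [mul_assoc]
  rw [← CStarAlgebra.toReal_spectralRadius_star_mul_self_eq_norm_sq, hrad]
  have hnorm : ‖star T * (E * T' * E)‖ * ‖(1 : ℓ²(K, ℂ) →L[ℂ] ℓ²(K, ℂ))‖ ≤ ‖T‖ * ‖T'‖ := by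
    calc ‖star T * (E * T' * E)‖ * ‖(1 : ℓ²(K, ℂ) →L[ℂ] ℓ²(K, ℂ))‖
        ≤ ‖star T‖ * (‖E‖ * ‖T'‖ * ‖E‖) * 1 := by
          gcongr
          · exact (norm_mul_le _ _).trans (by gcongr; exact norm_mul₃_le)
          · exact ContinuousLinearMap.norm_id_le
      _ ≤ ‖star T‖ * (1 * ‖T'‖ * 1) * 1 := by gcongr
      _ = ‖T‖ * ‖T'‖ := by rw [show ‖star T‖ = ‖T‖ from norm_star T]; ring
  refine ENNReal.toReal_le_of_le_ofReal (by positivity) ?_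
  calc spectralRadius ℂ (star T * (E * T' * E))
      ≤ ‖star T * (E * T' * E)‖₊ * ‖(1 : ℓ²(K, ℂ) →L[ℂ] ℓ²(K, ℂ))‖₊ :=
        spectralRadius_le_nnnorm_mul_nnnorm_one _
    _ ≤ ENNReal.ofReal (‖T‖ * ‖T'‖) := by
        rw [← ENNReal.coe_mul]
        exact ENNReal.coe_le_coe.2 (NNReal.le_toNNReal_of_coe_le hnorm)

theorem exists_sqrt (h : IsWeightConj w T T') :
    ∃ V, IsWeightConj w.sqrt T V ∧ ‖V‖ ^ 2 ≤ ‖T‖ * ‖T'‖ := by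
  have hbound : FiniteSectionBound (conjDiag w.sqrt (opMatrix T)) √(‖T‖ * ‖T'‖) := fun F =>
    ⟨finDiag F w.sqrt * T * finDiag F w⁻¹.sqrt,
      Real.le_sqrt_of_sq_le (h.norm_sq_finDiag_sqrt_mul_mul_le F), fun k hk l hl => by
        rw [opMatrix_finDiag_mul_mul, if_pos ⟨hk, hl⟩, PosWeight.sqrt_inv, PosWeight.inv_apply,
          conjDiag]⟩
  obtain ⟨V, hV, hVn⟩ := hbound.exists_opMatrix_eq
  exact ⟨V, hV, (Real.le_sqrt (norm_nonneg V) (by positivity)).1 hVn⟩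

theorem norm_sq_le (h : IsWeightConj w T T') (hV : IsWeightConj w.sqrt T V) :
    ‖V‖ ^ 2 ≤ ‖T‖ * ‖T'‖ := by
  obtain ⟨V', hV', hle⟩ := h.exists_sqrt
  rwa [hV.unique hV']

theorem spectralRadius_sq_le (h : IsWeightConj w T T') (hV : IsWeightConj w.sqrt T V) :
    spectralRadius ℂ V ^ 2 ≤ spectralRadius ℂ T * spectralRadius ℂ T' :=
  spectralRadius_sq_le_mul fun n => (h.pow n).norm_sq_le (hV.pow n)

end IsWeightConj

end Interpolation

/-! ## Matrices acting on weighted sequence spaces -/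

namespace WeightedLp

variable {K : Type u} {w w' : PosWeight K} {p : ℝ≥0∞}

theorem ext {c d : WeightedLp w p} (h : ∀ k, c.1 k = d.1 k) : c = d :=
  Subtype.ext (funext h)

variable [Fact (1 ≤ p)]

variable (w p) in
/-- Multiplication by `w`, as an isometric isomorphism of `ℓ^p_w(K)` onto `ℓ^p(K)`. -/
def equivLp : WeightedLp w p ≃ₗᵢ[ℂ] lp (fun _ : K => ℂ) p where
  toLinearEquiv := LinearEquiv.ofBijective (toLp w p) ⟨toLp_injective w p, fun x =>
    have hx (k : K) : (w k : ℂ) * ((w k : ℂ)⁻¹ * x k) = x k :=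
      mul_inv_cancel_left₀ (w.ofReal_ne_zero k) (x k)
    ⟨⟨fun k => (w k : ℂ)⁻¹ * x k, show Memℓp (fun k => (w k : ℂ) * ((w k : ℂ)⁻¹ * x k)) p by
        simpa only [hx] using lp.memℓp x⟩,
      lp.ext (funext hx)⟩⟩
  norm_map' _ := rfl

theorem equivLp_apply (c : WeightedLp w p) (k : K) : equivLp w p c k = w k * c.1 k := rfl

theorem equivLp_symm_apply (x : lp (fun _ : K => ℂ) p) (k : K) :
    ((equivLp w p).symm x).1 k = (w k : ℂ)⁻¹ * x k := by
  obtain ⟨c, rfl⟩ := (equivLp w p).surjective x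
  rw [LinearIsometryEquiv.symm_apply_apply, equivLp_apply,
    inv_mul_cancel_left₀ (w.ofReal_ne_zero k)]

instance : CompleteSpace (WeightedLp w p) :=
  (equivLp w p).toIsometryEquiv.completeSpace

theorem norm_mul_apply_le (c : WeightedLp w p) (k : K) : w k * ‖c.1 k‖ ≤ ‖c‖ := by
  have h := lp.norm_apply_le_norm (zero_lt_one.trans_le (Fact.out : 1 ≤ p)).ne' (equivLp w p c) k
  rwa [equivLp_apply, norm_mul, Complex.norm_real, Real.norm_of_nonneg (w.pos k).le] at h

theorem norm_apply_le (c : WeightedLp w p) (k : K) : ‖c.1 k‖ ≤ ‖c‖ * (w k)⁻¹ := by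
  rw [← div_eq_mul_inv, le_div_iff₀' (w.pos k)]
  exact norm_mul_apply_le c k

theorem summable_norm_mul_inv (c : WeightedLp w⁻¹ 1) : Summable fun k => ‖c.1 k‖ * (w k)⁻¹ := by
  have h := (lp.memℓp (equivLp w⁻¹ 1 c)).summable (by norm_num)
  refine h.congr fun k => ?_
  rw [ENNReal.toReal_one, Real.rpow_one, equivLp_apply, norm_mul, Complex.norm_real,
    Real.norm_of_nonneg (w⁻¹.pos k).le, mul_comm, PosWeight.inv_apply]

variable (w w' p) in
/-- Multiplication by `w / w'`, as an isometric isomorphism of `ℓ^p_w(K)` onto `ℓ^p_{w'}(K)`. -/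
def changeWeight : WeightedLp w p ≃ₗᵢ[ℂ] WeightedLp w' p :=
  (equivLp w p).trans (equivLp w' p).symm

theorem changeWeight_apply (c : WeightedLp w p) (k : K) :
    (changeWeight w w' p c).1 k = (w / w') k * c.1 k := by
  rw [changeWeight, LinearIsometryEquiv.trans_apply, equivLp_symm_apply, equivLp_apply,
    PosWeight.div_apply, Complex.ofReal_div, ← mul_assoc, div_eq_inv_mul]

open scoped Classical in
variable (w p) in
/-- The canonical unit vector `e_k` as an element of `ℓ^p_w(K)`. -/
def delta (k : K) : WeightedLp w p := (equivLp w p).symm (lp.single p k (w k : ℂ))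

theorem hasSum_mul_delta (a : K → ℂ) (k : K) :
    HasSum (fun l => a l * (delta w p k).1 l) (a k) := by
  classical
  convert hasSum_single k fun l hl => ?_ using 1
  · simp [delta, equivLp_symm_apply, w.ofReal_ne_zero k]
  · simp [delta, equivLp_symm_apply, hl]

theorem hasSum_smul_delta (hp : p ≠ ∞) (c : WeightedLp w p) :
    HasSum (fun k => c.1 k • delta w p k) c := by
  classical
  refine (equivLp w p).toContinuousLinearEquiv.hasSum'.1
    ((lp.hasSum_single hp (equivLp w p c)).congr_fun fun k => ?_)
  rw [LinearIsometryEquiv.coe_toContinuousLinearEquiv, map_smul, delta,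
    LinearIsometryEquiv.apply_symm_apply, ← lp.single_smul, equivLp_apply, smul_eq_mul, mul_comm]

theorem equivLp_symm_unitVec (k : K) :
    (equivLp w 2).symm (unitVec k) = (w k : ℂ)⁻¹ • delta w 2 k := by
  classical
  rw [delta, ← map_smul, ← lp.single_smul, smul_eq_mul, inv_mul_cancel₀ (w.ofReal_ne_zero k),
    unitVec]

end WeightedLp

namespace ActsBoundedly

variable {K : Type u} {M : Matrix K K ℂ} {p : ℝ≥0∞} [Fact (1 ≤ p)] {w : PosWeight K}

/-- The bounded operator on `ℓ^p_w(K)` given by a matrix acting boundedly. -/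
def toCLM (h : ActsBoundedly M p w) : WeightedLp w p →L[ℂ] WeightedLp w p :=
  have hsum (c k) := (h.choose_spec c).choose_spec.1 k
  LinearMap.mkContinuous
    { toFun := fun c => (h.choose_spec c).choose
      map_add' := fun c d => WeightedLp.ext fun k => (hsum (c + d) k).unique <|
        ((hsum c k).add (hsum d k)).congr_fun fun l => mul_add (M k l) (c.1 l) (d.1 l)
      map_smul' := fun a c => WeightedLp.ext fun k => (hsum (a • c) k).unique <|
        ((hsum c k).mul_left a).congr_fun fun l => mul_left_comm (M k l) a (c.1 l) }
    h.choose fun c => (h.choose_spec c).choose_spec.2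

theorem hasSum_toCLM (h : ActsBoundedly M p w) (c : WeightedLp w p) (k : K) :
    HasSum (fun l => M k l * c.1 l) ((h.toCLM c).1 k) :=
  (h.choose_spec c).choose_spec.1 k

theorem toCLM_delta_apply (h : ActsBoundedly M p w) (k l : K) :
    (h.toCLM (WeightedLp.delta w p l)).1 k = M k l :=
  (h.hasSum_toCLM _ k).unique (WeightedLp.hasSum_mul_delta (M k) l)

theorem toCLM_eq_of_hasSum (h : ActsBoundedly M p w) {S : WeightedLp w p →L[ℂ] WeightedLp w p}
    (hS : ∀ c k, HasSum (fun l => M k l * c.1 l) ((S c).1 k)) : h.toCLM = S :=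
  ContinuousLinearMap.ext fun c => WeightedLp.ext fun k => (h.hasSum_toCLM c k).unique (hS c k)

theorem exists_hasSum_norm_row (h : ActsBoundedly M ∞ w) :
    ∃ C : ℝ, ∀ k, ∃ r ≤ C * (w k)⁻¹, HasSum (fun l => ‖M k l‖ * (w l)⁻¹) r := by
  refine ⟨‖h.toCLM‖, fun k => ?_⟩
  -- Test against the conjugate phases of the `k`-th row.
  let x : K → ℂ := fun l => conj (M k l) / ‖M k l‖
  have hx (l : K) : ‖x l‖ ≤ 1 := by
    rw [norm_div, RCLike.norm_conj, Complex.norm_real, norm_norm]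
    exact div_self_le_one _
  let c : WeightedLp w ∞ := (WeightedLp.equivLp w ∞).symm
    ⟨x, memℓp_infty ⟨1, by rintro _ ⟨l, rfl⟩; exact hx l⟩⟩
  have hc : ‖c‖ ≤ 1 := by
    rw [LinearIsometryEquiv.norm_map]
    exact lp.norm_le_of_forall_le zero_le_one hx
  have hterm (l : K) : M k l * c.1 l = ((‖M k l‖ * (w l)⁻¹ : ℝ) : ℂ) := by
    rw [show c.1 l = (w l : ℂ)⁻¹ * x l from WeightedLp.equivLp_symm_apply _ _, mul_left_comm,
      ← mul_div_assoc, Complex.mul_conj', sq, mul_self_div_self, Complex.ofReal_mul,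
      Complex.ofReal_inv, mul_comm]
  refine ⟨((h.toCLM c).1 k).re, ?_, ?_⟩
  · calc ((h.toCLM c).1 k).re ≤ ‖(h.toCLM c).1 k‖ := Complex.re_le_norm _
      _ ≤ ‖h.toCLM c‖ * (w k)⁻¹ := WeightedLp.norm_apply_le _ k
      _ ≤ ‖h.toCLM‖ * (w k)⁻¹ := by
        gcongr
        · exact (inv_pos.2 (w.pos k)).le
        · exact h.toCLM.unit_le_opNorm c hc
  · have hsum := h.hasSum_toCLM c k
    simp only [hterm] at hsum
    exact Complex.hasSum_re hsum

theorem summable_mul_mul (h : ActsBoundedly M ∞ w) {a : K → ℂ}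
    (ha : Summable fun j => ‖a j‖ * (w j)⁻¹) (c : WeightedLp w p) :
    Summable fun x : K × K => a x.1 * (M x.1 x.2 * c.1 x.2) := by
  obtain ⟨C, hC⟩ := h.exists_hasSum_norm_row
  choose r hrC hr using hC
  have hw0 (j : K) : 0 ≤ (w j)⁻¹ := (inv_pos.2 (w.pos j)).le
  have hr0 (j : K) : 0 ≤ r j := (hr j).nonneg fun l => mul_nonneg (norm_nonneg _) (hw0 l)
  have hmajorant : Summable fun x : K × K =>
      ‖a x.1‖ * ‖c‖ * (‖M x.1 x.2‖ * (w x.2)⁻¹) := by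
    refine (summable_prod_of_nonneg fun x => ?_).2
      ⟨fun j => (hr j).summable.mul_left (‖a j‖ * ‖c‖), ?_⟩
    · exact mul_nonneg (by positivity) (mul_nonneg (norm_nonneg _) (hw0 x.2))
    · refine (ha.mul_left (‖c‖ * C)).of_nonneg_of_le (fun j => ?_) fun j => ?_
      · simp only [tsum_mul_left, (hr j).tsum_eq]
        exact mul_nonneg (by positivity) (hr0 j)
      · simp only [tsum_mul_left, (hr j).tsum_eq]
        calc ‖a j‖ * ‖c‖ * r j ≤ ‖a j‖ * ‖c‖ * (C * (w j)⁻¹) := by gcongr; exact hrC j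
          _ = ‖c‖ * C * (‖a j‖ * (w j)⁻¹) := by ring
  refine hmajorant.of_norm_bounded fun x => ?_
  rw [norm_mul, norm_mul]
  calc ‖a x.1‖ * (‖M x.1 x.2‖ * ‖c.1 x.2‖)
      ≤ ‖a x.1‖ * (‖M x.1 x.2‖ * (‖c‖ * (w x.2)⁻¹)) := by
        gcongr; exact WeightedLp.norm_apply_le c x.2
    _ = ‖a x.1‖ * ‖c‖ * (‖M x.1 x.2‖ * (w x.2)⁻¹) := by ring

theorem hasSum_toCLM_toCLM {N R : Matrix K K ℂ} (hM : ActsBoundedly M p w)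
    (hN : ActsBoundedly N p w) (hM' : ActsBoundedly M ∞ w) (hN' : ActsBoundedly N ∞ w)
    (hMN : ∀ k l, HasSum (fun j => M k j * N j l) (R k l)) (c : WeightedLp w p) (k : K) :
    HasSum (fun l => R k l * c.1 l) ((hM.toCLM (hN.toCLM c)).1 k) := by
  obtain ⟨C, hC⟩ := hM'.exists_hasSum_norm_row
  obtain ⟨r, -, hr⟩ := hC k
  have hdouble := (hN'.summable_mul_mul hr.summable c).hasSum
  have hrows := hdouble.prod_fiberwise fun j => (hN.hasSum_toCLM c j).mul_left (M k j)
  have hcolumns := ((Equiv.prodComm K K).hasSum_iff.2 hdouble).prod_fiberwise fun l =>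
    ((hMN k l).mul_right (c.1 l)).congr_fun fun j => (mul_assoc (M k j) (N j l) (c.1 l)).symm
  rwa [hrows.unique (hM.hasSum_toCLM (hN.toCLM c) k)] at hcolumns

end ActsBoundedly

/-! ## Inverse-closedness and representations of ARI-algebras -/

namespace ARIAlgebra

variable {K : Type u} (A : ARIAlgebra K)

/-- The algebra of an ARI-algebra, endowed with its own Banach algebra norm instead of the operator
norm. -/
def Carrier : Type u := A.alg

instance : Ring A.Carrier := inferInstanceAs (Ring A.alg)

instance : Algebra ℂ A.Carrier := inferInstanceAs (Algebra ℂ A.alg)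

instance : StarRing A.Carrier := inferInstanceAs (StarRing A.alg)

instance : StarModule ℂ A.Carrier := inferInstanceAs (StarModule ℂ A.alg)

instance : NormedRing A.Carrier :=
  RingNorm.toNormedRing (R := A.Carrier) (A.algNorm.toRingNorm : RingNorm A.alg)

instance : NormedAlgebra ℂ A.Carrier where
  norm_smul_le c a := (A.algNorm.smul' c (show A.alg from a)).le

instance : CompleteSpace A.Carrier := by
  refine Metric.complete_of_cauchySeq_tendsto fun a ha => ?_
  obtain ⟨b, hb⟩ := A.complete (fun i => (show A.alg from a i)) fun ε hε => by
    obtain ⟨N, hN⟩ := Metric.cauchySeq_iff.1 ha ε hε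
    exact ⟨N, fun i hi j hj => (dist_eq_norm (a i) (a j)).symm.trans_lt (hN i hi j hj)⟩
  exact ⟨b, tendsto_iff_norm_sub_tendsto_zero.2 hb⟩

instance : IsLocalHom A.alg.subtype.toAlgHom where
  map_nonunit T hT := by
    let S : A.alg := ⟨Ring.inverse T.1, A.inverse_closed T T.2 hT⟩
    exact isUnit_iff_exists.2 ⟨S, Subtype.ext (Ring.mul_inverse_cancel _ hT),
      Subtype.ext (Ring.inverse_mul_cancel _ hT)⟩

/-- The inclusion of the algebra in the bounded operators on `ℓ²(K)`, which is continuous for the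
Banach algebra norm. -/
def incl : A.Carrier →A[ℂ] (ℓ²(K, ℂ) →L[ℂ] ℓ²(K, ℂ)) :=
  let φ : A.Carrier →⋆ₐ[ℂ] (ℓ²(K, ℂ) →L[ℂ] ℓ²(K, ℂ)) := A.alg.subtype
  { (φ : A.Carrier →ₐ[ℂ] (ℓ²(K, ℂ) →L[ℂ] ℓ²(K, ℂ))) with
    cont := continuous_starAlgHom_of_injective (φ := φ) Subtype.val_injective }

instance : IsLocalHom A.incl where
  map_nonunit a h := IsUnit.of_map A.alg.subtype.toAlgHom (show A.alg from a) h

variable {A} {T R Z : ℓ²(K, ℂ) →L[ℂ] ℓ²(K, ℂ)} {w μ : PosWeight K}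

theorem mem_of_isGroupInverse (hT : T ∈ A.alg) (h : IsGroupInverse T R) : R ∈ A.alg := by
  obtain ⟨⟨S, hS⟩, rfl⟩ :=
    IsGroupInverse.mem_range_of_isLocalHom A.incl (g := (⟨T, hT⟩ : A.alg)) h
  exact hS

/-- The representation of the algebra on `ℓ^p_w(K)`, for an admissible weight `w`. -/
def rep (hw : w ∈ A.W) (p : ℝ≥0∞) [Fact (1 ≤ p)] :
    A.alg →ₐ[ℂ] (WeightedLp w p →L[ℂ] WeightedLp w p) :=
  have hT (T : A.alg) (q : ℝ≥0∞) [Fact (1 ≤ q)] : ActsBoundedly (opMatrix T.1) q w :=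
    A.regular T T.2 w hw q
  AlgHom.ofLinearMap
    { toFun := fun T => (hT T p).toCLM
      map_add' := fun S T => (hT _ p).toCLM_eq_of_hasSum fun c k =>
        (((hT S p).hasSum_toCLM c k).add ((hT T p).hasSum_toCLM c k)).congr_fun fun l =>
          add_mul (opMatrix S.1 k l) (opMatrix T.1 k l) (c.1 l)
      map_smul' := fun a T => (hT _ p).toCLM_eq_of_hasSum fun c k =>
        (((hT T p).hasSum_toCLM c k).mul_left a).congr_fun fun l =>
          mul_assoc a (opMatrix T.1 k l) (c.1 l) }
    ((hT 1 p).toCLM_eq_of_hasSum fun c k => by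
      classical
      convert hasSum_single k fun l hl => ?_ using 1
      · simp [opMatrix_one]
      · simp [opMatrix_one, hl.symm])
    fun S T => (hT _ p).toCLM_eq_of_hasSum fun c k => (hT S p).hasSum_toCLM_toCLM (hT T p)
      (hT S ∞) (hT T ∞) (hasSum_opMatrix_comp S.1 T.1) c k

theorem hasSum_rep (hw : w ∈ A.W) {p : ℝ≥0∞} [Fact (1 ≤ p)] (T : A.alg) (c : WeightedLp w p)
    (k : K) : HasSum (fun l => opMatrix T.1 k l * c.1 l) ((rep hw p T c).1 k) :=
  (A.regular T T.2 w hw p).hasSum_toCLM c k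

theorem rep_delta_apply (hw : w ∈ A.W) {p : ℝ≥0∞} [Fact (1 ≤ p)] (T : A.alg) (k l : K) :
    (rep hw p T (WeightedLp.delta w p l)).1 k = opMatrix T.1 k l :=
  (A.regular T T.2 w hw p).toCLM_delta_apply k l

theorem rep_apply_rep_apply_of_mul_eq (hw : w ∈ A.W) {S T R : A.alg} (h : S.1 * T.1 = R.1)
    {p : ℝ≥0∞} [Fact (1 ≤ p)] (c : WeightedLp w p) :
    rep hw p S (rep hw p T c) = rep hw p R c := by
  rw [← mul_apply_eq_comp, ← map_mul, show S * T = R from Subtype.ext h]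

theorem changeWeight_rep_changeWeight {w₁ w₂ : PosWeight K} (hw₁ : w₁ ∈ A.W)
    (hw₂ : w₂ ∈ A.W) {T T' : A.alg} (h : IsWeightConj (w₂ / w₁) T.1 T'.1) {p : ℝ≥0∞} [Fact (1 ≤ p)]
    (c : WeightedLp w₁ p) :
    WeightedLp.changeWeight w₂ w₁ p (rep hw₂ p T (WeightedLp.changeWeight w₁ w₂ p c)) =
      rep hw₁ p T' c := WeightedLp.ext fun k => by
  rw [WeightedLp.changeWeight_apply]
  refine (((hasSum_rep hw₂ T _ k).mul_left _).congr_fun fun l => ?_).unique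
    (hasSum_rep hw₁ T' c k)
  rw [h.opMatrix_apply, WeightedLp.changeWeight_apply, ← inv_div w₂ w₁, PosWeight.inv_apply]
  push_cast
  ring

/-- The representation `T ↦ diag(w) T diag(1/w)` of the algebra on `ℓ²(K)`, for an admissible
weight `w`. -/
def weightRep (hw : w ∈ A.W) : A.alg →ₐ[ℂ] (ℓ²(K, ℂ) →L[ℂ] ℓ²(K, ℂ)) :=
  ((WeightedLp.equivLp w 2).toContinuousLinearEquiv.conjContinuousAlgEquiv :
    _ →ₐ[ℂ] (ℓ²(K, ℂ) →L[ℂ] ℓ²(K, ℂ))).comp (rep hw 2)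

theorem isWeightConj_weightRep (hw : w ∈ A.W) (T : A.alg) :
    IsWeightConj w T.1 (weightRep hw T) := .of_opMatrix_apply fun k l => by
  have h : weightRep hw T (unitVec l) =
      WeightedLp.equivLp w 2 (rep hw 2 T ((WeightedLp.equivLp w 2).symm (unitVec l))) := rfl
  rw [opMatrix_apply, h, WeightedLp.equivLp_symm_unitVec, map_smul, WeightedLp.equivLp_apply,
    mul_assoc, mul_comm (opMatrix T.1 k l), ← rep_delta_apply hw (p := 2) T k l]
  rfl

/-- By inverse-closedness the spectral radius can be computed in the algebra, where it decreases
under every representation. -/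
theorem spectralRadius_weightRep_le (hw : w ∈ A.W) (T : A.alg) :
    spectralRadius ℂ (weightRep hw T) ≤ spectralRadius ℂ T.1 :=
  (spectralRadius_map_le (weightRep hw) T).trans
    (spectralRadius_le_map_of_isLocalHom A.alg.subtype.toAlgHom T)

/-- The spectral radius of `diag(μ)^s T diag(μ)^(-s)` is log-convex in `s`, and it is at most `r(T)`
at `s = -1`. The second comparison is between `s = -1 / 2`, `s = 0` and `s = 1 / 2`. -/
theorem spectralRadius_le_of_isWeightConj_sqrt (hT : T ∈ A.alg) (hμ : μ ∈ A.W)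
    (hZ : IsWeightConj μ.sqrt T Z) : spectralRadius ℂ T ≤ spectralRadius ℂ Z := by
  have hX := isWeightConj_weightRep (A.inv_mem μ hμ) ⟨T, hT⟩
  obtain ⟨V, hV, -⟩ := hX.exists_sqrt
  have hVT : spectralRadius ℂ V ≤ spectralRadius ℂ T := by
    rw [← ENNReal.pow_le_pow_left_iff two_ne_zero, sq (spectralRadius ℂ T)]
    exact (hX.spectralRadius_sq_le hV).trans
      (mul_le_mul_right (spectralRadius_weightRep_le _ ⟨T, hT⟩) _)
  rw [PosWeight.sqrt_inv] at hV
  have hVT' : IsWeightConj μ.sqrt V T := inv_inv μ.sqrt ▸ hV.symm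
  have hVZ : IsWeightConj μ V Z := μ.sqrt_mul_sqrt ▸ hVT'.trans hZ
  have hsq : spectralRadius ℂ T * spectralRadius ℂ T ≤ spectralRadius ℂ T * spectralRadius ℂ Z :=
    calc _ = spectralRadius ℂ T ^ 2 := (sq _).symm
      _ ≤ spectralRadius ℂ V * spectralRadius ℂ Z := hVZ.spectralRadius_sq_le hVT'
      _ ≤ _ := mul_le_mul_left hVT _
  rcases eq_or_ne (spectralRadius ℂ T) 0 with h0 | h0
  · exact h0 ▸ zero_le
  · exact (ENNReal.mul_le_mul_iff_right h0 (spectralRadius_ne_top T)).1 hsq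

end ARIAlgebra

namespace ARIAlgebra

variable {K : Type u} {A : ARIAlgebra K} {G L N : ℓ²(K, ℂ) →L[ℂ] ℓ²(K, ℂ)} {μ : PosWeight K}

theorem exists_spectralRadius_sub_smul_lt_one (hG : G ∈ A.alg) (hGsa : IsSelfAdjoint G)
    (hGL : IsGroupInverse G L) (hμ : μ ∈ A.W) (hNmem : N ∈ A.alg) (hN : IsWeightConj μ⁻¹ G N) :
    ∃ t : ℂ, spectralRadius ℂ (L * G - t • (L * G * (N * G))) < 1 := by
  have hL : L ∈ A.alg := mem_of_isGroupInverse hG hGL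
  obtain ⟨V, (hV : IsWeightConj μ.sqrt G V), -⟩ := (isWeightConj_weightRep hμ ⟨G, hG⟩).exists_sqrt
  obtain ⟨J, (hJ : IsWeightConj μ.sqrt L J), -⟩ := (isWeightConj_weightRep hμ ⟨L, hL⟩).exists_sqrt
  have hV_adjoint : IsWeightConj μ.sqrt V.adjoint G :=
    (ContinuousLinearMap.isSelfAdjoint_iff'.1 hGsa) ▸ hV.adjoint
  -- Conjugating by `√μ` makes the product `N * G` positive.
  have hN_adjoint : IsWeightConj μ.sqrt N V.adjoint := by
    have hμ_sqrt : μ.sqrt⁻¹ * μ = μ.sqrt := by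
      rw [inv_mul_eq_iff_eq_mul, PosWeight.sqrt_mul_sqrt]
    have hNG : IsWeightConj μ N G := inv_inv μ ▸ hN.symm
    exact hμ_sqrt ▸ hNG.trans hV_adjoint.symm
  have hVJV : V * J * V = V :=
    IsWeightConj.unique (hGL.mul_mul_cancel_left ▸ (hV.mul hJ).mul hV) hV
  obtain ⟨t, -, ht⟩ := exists_spectralRadius_sub_smul_adjoint_mul_lt_one hVJV
  refine ⟨t, lt_of_le_of_lt (spectralRadius_le_of_isWeightConj_sqrt ?_ hμ
    ((hJ.mul hV).sub (((hJ.mul hV).mul (hN_adjoint.mul hV)).smul t))) ht⟩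
  exact sub_mem (mul_mem hL hG) (A.alg.smul_mem (mul_mem (mul_mem hL hG) (mul_mem hNmem hG)) _)

theorem exists_isGroupInverse_mul_mul (hG : G ∈ A.alg) (hGsa : IsSelfAdjoint G)
    (hGL : IsGroupInverse G L) (hμ : μ ∈ A.W) (hNmem : N ∈ A.alg) (hN : IsWeightConj μ⁻¹ G N) :
    ∃ Y, IsGroupInverse (L * G * (N * G)) Y ∧ L * G * (N * G) * Y = L * G := by
  obtain ⟨t, ht⟩ := exists_spectralRadius_sub_smul_lt_one hG hGsa hGL hμ hNmem hN
  have hP : IsIdempotentElem (L * G) := by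
    rw [IsIdempotentElem, ← mul_assoc, hGL.mul_mul_cancel_right]
  have hGP : G * (L * G) = G := by rw [← mul_assoc, hGL.mul_mul_cancel_left]
  exact IsGroupInverse.exists_of_isUnit_one_sub hP (by rw [← mul_assoc, hP.eq])
    (by rw [mul_assoc, mul_assoc N, hGP]) (isUnit_one_sub_of_spectralRadius_lt_one ht)

end ARIAlgebra

/-! ## Gram operators of frames -/

namespace HilbertFrame

variable {K : Type u} {H : Type v} [NormedAddCommGroup H] [InnerProductSpace ℂ H]
  [CompleteSpace H] (Ψ : HilbertFrame K H)

/-- The Gram matrix as a bounded operator on `ℓ²(K)`. -/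
def gramOp : ℓ²(K, ℂ) →L[ℂ] ℓ²(K, ℂ) := Ψ.analysis ∘L Ψ.analysis.adjoint

/-- The Gram matrix of the canonical dual frame as a bounded operator on `ℓ²(K)`. -/
def dualGramOp : ℓ²(K, ℂ) →L[ℂ] ℓ²(K, ℂ) :=
  Ψ.analysis ∘L (Ring.inverse Ψ.frameOp) ∘L (Ring.inverse Ψ.frameOp) ∘L Ψ.analysis.adjoint

/-- The cross Gram matrix `(⟨ψ_l, ψ̃_k⟩)_{kl}`, which is the orthogonal projection of `ℓ²(K)` onto
the range of the analysis operator. -/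
def rangeProj : ℓ²(K, ℂ) →L[ℂ] ℓ²(K, ℂ) :=
  Ψ.analysis ∘L (Ring.inverse Ψ.frameOp) ∘L Ψ.analysis.adjoint

theorem inverse_frameOp_frameOp (f : H) : (Ring.inverse Ψ.frameOp) (Ψ.frameOp f) = f :=
  congrArg (fun T : H →L[ℂ] H => T f) (Ring.inverse_mul_cancel Ψ.frameOp Ψ.isUnit_frameOp)

theorem gramOp_mul_dualGramOp : Ψ.gramOp * Ψ.dualGramOp = Ψ.rangeProj :=
  ContinuousLinearMap.ext fun _ => congrArg Ψ.analysis (Ψ.frameOp_inverse _)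

theorem dualGramOp_mul_gramOp : Ψ.dualGramOp * Ψ.gramOp = Ψ.rangeProj :=
  ContinuousLinearMap.ext fun x => congrArg (fun f => Ψ.analysis ((Ring.inverse Ψ.frameOp) f))
    (Ψ.inverse_frameOp_frameOp (Ψ.analysis.adjoint x))

theorem rangeProj_mul_gramOp : Ψ.rangeProj * Ψ.gramOp = Ψ.gramOp :=
  ContinuousLinearMap.ext fun _ => congrArg Ψ.analysis (Ψ.inverse_frameOp_frameOp _)

theorem rangeProj_mul_dualGramOp : Ψ.rangeProj * Ψ.dualGramOp = Ψ.dualGramOp :=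
  ContinuousLinearMap.ext fun _ => congrArg Ψ.analysis (Ψ.inverse_frameOp_frameOp _)

theorem isGroupInverse_gramOp : IsGroupInverse Ψ.gramOp Ψ.dualGramOp where
  comm := Ψ.gramOp_mul_dualGramOp.trans Ψ.dualGramOp_mul_gramOp.symm
  mul_mul_cancel_left := by rw [gramOp_mul_dualGramOp, rangeProj_mul_gramOp]
  mul_mul_cancel_right := by rw [dualGramOp_mul_gramOp, rangeProj_mul_dualGramOp]

theorem isSelfAdjoint_gramOp : IsSelfAdjoint Ψ.gramOp := by
  rw [ContinuousLinearMap.isSelfAdjoint_iff', gramOp, ContinuousLinearMap.adjoint_comp,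
    ContinuousLinearMap.adjoint_adjoint]

theorem adjoint_analysis_unitVec (k : K) : Ψ.analysis.adjoint (unitVec k) = Ψ.vec k := by
  refine ext_inner_left ℂ fun g => ?_
  rw [ContinuousLinearMap.adjoint_inner_right, ← inner_conj_symm, inner_unitVec_left,
    analysis_apply, inner_conj_symm]

theorem opMatrix_gramOp : opMatrix Ψ.gramOp = Ψ.gram := by
  funext k l
  rw [opMatrix_apply, gramOp, ContinuousLinearMap.comp_apply, adjoint_analysis_unitVec,
    analysis_apply, gram]

theorem opMatrix_rangeProj (k l : K) : opMatrix Ψ.rangeProj k l = ⟪Ψ.dual k, Ψ.vec l⟫_ℂ := by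
  rw [opMatrix_apply, rangeProj, ContinuousLinearMap.comp_apply, ContinuousLinearMap.comp_apply,
    adjoint_analysis_unitVec, analysis_apply, dual, inner_inverse_frameOp]

theorem conj_opMatrix_rangeProj (k l : K) :
    conj (opMatrix Ψ.rangeProj k l) = opMatrix Ψ.rangeProj l k := by
  rw [opMatrix_rangeProj, opMatrix_rangeProj, inner_conj_symm, dual, dual, inner_inverse_frameOp]

theorem rangeProj_mul_rangeProj : Ψ.rangeProj * Ψ.rangeProj = Ψ.rangeProj := by
  simpa only [mul_assoc, gramOp_mul_dualGramOp] using
    congrArg (· * Ψ.dualGramOp) Ψ.rangeProj_mul_gramOp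

theorem gramOp_mul_rangeProj : Ψ.gramOp * Ψ.rangeProj = Ψ.gramOp := by
  rw [← dualGramOp_mul_gramOp, ← mul_assoc, Ψ.isGroupInverse_gramOp.mul_mul_cancel_left]

theorem hasSum_rangeProj_mul_dualCoeff (f : H) (k : K) :
    HasSum (fun l => opMatrix Ψ.rangeProj k l * Ψ.dualCoeff f l) (Ψ.dualCoeff f k) := by
  refine ((Ψ.hasSum_dual f).mapL (innerSL ℂ (Ψ.dual k))).congr_fun fun l => ?_
  rw [innerSL_apply_apply, inner_smul_right, opMatrix_rangeProj, mul_comm]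
  rfl

variable {A : ARIAlgebra K}

theorem gramOp_mem (hG : A.MemMatrix Ψ.gram) : Ψ.gramOp ∈ A.alg := by
  obtain ⟨T, hT, hTG⟩ := hG
  rwa [← opMatrix_injective (hTG.trans Ψ.opMatrix_gramOp.symm)]

theorem dualGramOp_mem (hG : A.MemMatrix Ψ.gram) : Ψ.dualGramOp ∈ A.alg :=
  ARIAlgebra.mem_of_isGroupInverse (Ψ.gramOp_mem hG) Ψ.isGroupInverse_gramOp

theorem rangeProj_mem (hG : A.MemMatrix Ψ.gram) : Ψ.rangeProj ∈ A.alg :=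
  Ψ.gramOp_mul_dualGramOp ▸ mul_mem (Ψ.gramOp_mem hG) (Ψ.dualGramOp_mem hG)

theorem memMatrix_conjDiag_inv {w : PosWeight K}
    (hGw : A.MemMatrix (conjDiag w Ψ.gram)) : A.MemMatrix (conjDiag w⁻¹ Ψ.gram) := by
  obtain ⟨N, hN, hGN⟩ := hGw
  rw [← opMatrix_gramOp] at hGN ⊢
  refine ⟨N.adjoint, star_mem hN, ?_⟩
  have h := (IsWeightConj.adjoint hGN).symm
  rwa [ContinuousLinearMap.isSelfAdjoint_iff'.1 Ψ.isSelfAdjoint_gramOp] at h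

end HilbertFrame

/-! ## Coorbit spaces of localized frames -/

namespace HilbertFrame

variable {K : Type u} {H : Type v} [NormedAddCommGroup H] [InnerProductSpace ℂ H]
  [CompleteSpace H] {Ψ : HilbertFrame K H} {A : ARIAlgebra K} {w : PosWeight K}
  (hG : A.MemMatrix Ψ.gram) (hw : w ∈ A.W) (p : ℝ≥0∞) [Fact (1 ≤ p)]

/-- The Gram matrix as a bounded operator on `ℓ^p_w(K)`. -/
def gramRep : WeightedLp w p →L[ℂ] WeightedLp w p :=
  A.rep hw p ⟨Ψ.gramOp, Ψ.gramOp_mem hG⟩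

/-- The cross Gram matrix `(⟨ψ_l, ψ̃_k⟩)_{kl}` as a bounded operator on `ℓ^p_w(K)`. -/
def projRep : WeightedLp w p →L[ℂ] WeightedLp w p :=
  A.rep hw p ⟨Ψ.rangeProj, Ψ.rangeProj_mem hG⟩

variable {p}

theorem hasSum_gramRep (c : WeightedLp w p) (k : K) :
    HasSum (fun l => c.1 l * ⟪Ψ.vec k, Ψ.vec l⟫_ℂ) ((gramRep hG hw p c).1 k) := by
  refine (ARIAlgebra.hasSum_rep hw ⟨Ψ.gramOp, Ψ.gramOp_mem hG⟩ c k).congr_fun fun l => ?_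
  rw [opMatrix_gramOp, gram, mul_comm]

theorem frameCoeff_eq_gramRep (c : WeightedLp w p) (k : K) :
    frameCoeff Ψ c.1 k = (gramRep hG hw p c).1 k :=
  (hasSum_gramRep hG hw c k).tsum_eq

theorem hasSum_projRep (c : WeightedLp w p) (k : K) :
    HasSum (fun l => opMatrix Ψ.rangeProj k l * c.1 l) ((projRep hG hw p c).1 k) :=
  ARIAlgebra.hasSum_rep hw ⟨Ψ.rangeProj, Ψ.rangeProj_mem hG⟩ c k

theorem projRep_delta (k : K) :
    (projRep hG hw p (WeightedLp.delta w p k)).1 = Ψ.dualCoeff (Ψ.vec k) :=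
  funext fun j => (ARIAlgebra.rep_delta_apply hw ⟨Ψ.rangeProj, Ψ.rangeProj_mem hG⟩ j k).trans
    (Ψ.opMatrix_rangeProj j k)

theorem projRep_projRep (c : WeightedLp w p) :
    projRep hG hw p (projRep hG hw p c) = projRep hG hw p c :=
  ARIAlgebra.rep_apply_rep_apply_of_mul_eq hw Ψ.rangeProj_mul_rangeProj c

theorem projRep_gramRep (c : WeightedLp w p) :
    projRep hG hw p (gramRep hG hw p c) = gramRep hG hw p c :=
  ARIAlgebra.rep_apply_rep_apply_of_mul_eq hw Ψ.rangeProj_mul_gramOp c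

theorem gramRep_projRep (c : WeightedLp w p) :
    gramRep hG hw p (projRep hG hw p c) = gramRep hG hw p c :=
  ARIAlgebra.rep_apply_rep_apply_of_mul_eq hw Ψ.gramOp_mul_rangeProj c

theorem projRep_eq_self_of_eq_dualCoeff {c : WeightedLp w p} {f : H} (hc : c.1 = Ψ.dualCoeff f) :
    projRep hG hw p c = c :=
  WeightedLp.ext fun k =>
    (hasSum_projRep hG hw c k).unique (hc ▸ Ψ.hasSum_rangeProj_mul_dualCoeff f k)

theorem projRep_eq_self_of_mem_weakStarCoorbit {c : WeightedLp w ∞}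
    (hc : c ∈ weakStarCoorbit Ψ ∞ w) : projRep hG hw ∞ c = c := by
  obtain ⟨f, -, ⟨B, hB⟩, hf⟩ := hc
  obtain ⟨C, hrow⟩ := (A.regular _ (Ψ.rangeProj_mem hG) w hw ∞).exists_hasSum_norm_row
  refine WeightedLp.ext fun k => ?_
  obtain ⟨_, -, hr⟩ := hrow k
  have htendsto : Filter.Tendsto (fun n => ∑' l, opMatrix Ψ.rangeProj k l * Ψ.dualCoeff (f n) l)
      Filter.atTop (nhds (∑' l, opMatrix Ψ.rangeProj k l * c.1 l)) := by
    refine tendsto_tsum_of_dominated_convergence (hr.summable.mul_right B)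
      (fun l => (hf l).const_mul _) (Filter.Eventually.of_forall fun n l => ?_)
    rw [norm_mul, mul_assoc]
    gcongr
    rw [← div_eq_inv_mul, le_div_iff₀' (w.pos l)]
    exact hB n l
  simp only [(Ψ.hasSum_rangeProj_mul_dualCoeff (f _) k).tsum_eq,
    (hasSum_projRep hG hw c k).tsum_eq] at htendsto
  exact tendsto_nhds_unique htendsto (hf k)

theorem mem_weakStarCoorbit_of_projRep_eq_self [Countable K] {c : WeightedLp w ∞}
    (hc : projRep hG hw ∞ c = c) : c ∈ weakStarCoorbit Ψ ∞ w := by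
  obtain ⟨s, hs⟩ := Filter.exists_seq_tendsto (Filter.atTop : Filter (Finset K))
  obtain ⟨C, hrow⟩ := (A.regular _ (Ψ.rangeProj_mem hG) w hw ∞).exists_hasSum_norm_row
  have hcoeff (n : ℕ) (k : K) : ⟪Ψ.dual k, ∑ l ∈ s n, c.1 l • Ψ.vec l⟫_ℂ =
      ∑ l ∈ s n, opMatrix Ψ.rangeProj k l * c.1 l := by
    simp only [inner_sum, inner_smul_right, opMatrix_rangeProj, mul_comm]
  refine ⟨fun n => ∑ l ∈ s n, c.1 l • Ψ.vec l,
    fun n => sum_mem fun l _ => Submodule.smul_mem _ _ (Submodule.subset_span ⟨l, rfl⟩),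
    ⟨C * ‖c‖, fun n k => ?_⟩, fun k => ?_⟩
  · obtain ⟨r, hr, hsum⟩ := hrow k
    rw [hcoeff, ← le_div_iff₀' (w.pos k)]
    calc ‖∑ l ∈ s n, opMatrix Ψ.rangeProj k l * c.1 l‖
        ≤ ∑ l ∈ s n, ‖opMatrix Ψ.rangeProj k l‖ * (w l)⁻¹ * ‖c‖ :=
          norm_sum_le_of_le _ fun l _ => by
            rw [norm_mul, mul_assoc, mul_comm (w l)⁻¹]
            gcongr
            exact WeightedLp.norm_apply_le c l
      _ ≤ r * ‖c‖ := by
          rw [← Finset.sum_mul]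
          gcongr
          exact sum_le_hasSum _ (fun l _ => mul_nonneg (norm_nonneg _)
            (inv_nonneg.2 (w.pos l).le)) hsum
      _ ≤ C * (w k)⁻¹ * ‖c‖ := by gcongr
      _ = C * ‖c‖ / w k := by ring
  · simp only [hcoeff]
    have hsum := hasSum_projRep hG hw c k
    rw [hc, HasSum, SummationFilter.unconditional_filter] at hsum
    exact hsum.comp hs

theorem isClosed_setOf_projRep_eq_self : IsClosed {c | projRep hG hw p c = c} :=
  isClosed_eq (projRep hG hw p).continuous continuous_id

theorem mem_topologicalClosure_finCoorbit_iff (hp : p ≠ ∞) (c : WeightedLp w p) :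
    c ∈ (finCoorbit Ψ p w).topologicalClosure ↔ projRep hG hw p c = c := by
  constructor
  · refine fun hc => closure_minimal ?_ (isClosed_setOf_projRep_eq_self hG hw) hc
    rintro d ⟨f, -, hf⟩
    exact projRep_eq_self_of_eq_dualCoeff hG hw hf.symm
  · intro hc
    have hsum := (WeightedLp.hasSum_smul_delta hp c).mapL (projRep hG hw p)
    rw [hc] at hsum
    refine mem_closure_of_tendsto hsum (Filter.Eventually.of_forall fun s =>
      sum_mem fun l _ => ?_)
    rw [map_smul]
    exact Submodule.smul_mem _ _
      ⟨Ψ.vec l, Submodule.subset_span ⟨l, rfl⟩, (projRep_delta hG hw l).symm⟩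

theorem mem_coorbitSpace_iff [Countable K] (c : WeightedLp w p) :
    c ∈ CoorbitSpace Ψ p w ↔ projRep hG hw p c = c := by
  rw [CoorbitSpace]
  split_ifs with hp
  · subst hp
    exact ⟨projRep_eq_self_of_mem_weakStarCoorbit hG hw,
      mem_weakStarCoorbit_of_projRep_eq_self hG hw⟩
  · exact mem_topologicalClosure_finCoorbit_iff hG hw hp c

variable [Countable K]

variable (p) in
include hG hw in
theorem completeSpace_coorbitSpace : CompleteSpace (CoorbitSpace Ψ p w) := by
  have h : (CoorbitSpace Ψ p w : Set (WeightedLp w p)) = {c | projRep hG hw p c = c} :=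
    Set.ext (mem_coorbitSpace_iff hG hw)
  exact (h ▸ isClosed_setOf_projRep_eq_self hG hw).completeSpace_coe

variable (p) in
/-- The projection of `ℓ^p_w(K)` onto the coorbit space. -/
def coorbitProj : WeightedLp w p →L[ℂ] CoorbitSpace Ψ p w :=
  (projRep hG hw p).codRestrict _ fun c =>
    (mem_coorbitSpace_iff hG hw _).2 (projRep_projRep hG hw c)

end HilbertFrame

/-! ## Frame multipliers -/

namespace HilbertFrame

variable {K : Type u} {H : Type v} [NormedAddCommGroup H] [InnerProductSpace ℂ H]
  [CompleteSpace H] {Ψ : HilbertFrame K H} {A : ARIAlgebra K} {w w₁ w₂ : PosWeight K}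
  (hG : A.MemMatrix Ψ.gram) (hw : w ∈ A.W) (hw₁ : w₁ ∈ A.W) (hw₂ : w₂ ∈ A.W)
  {p : ℝ≥0∞} [Fact (1 ≤ p)]

theorem hasSum_coorbitPairing_projRep (d : WeightedLp w ∞) (g : WeightedLp w⁻¹ 1) :
    HasSum (fun k => (projRep hG hw ∞ d).1 k * conj (frameCoeff Ψ g.1 k))
      (coorbitPairing Ψ (projRep hG hw ∞ d).1 g.1) ∧
    HasSum (fun k => d.1 k * conj (frameCoeff Ψ g.1 k))
      (coorbitPairing Ψ (projRep hG hw ∞ d).1 g.1) := by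
  have hw' := A.inv_mem w hw
  set h := gramRep hG hw' 1 g with hh
  have hgh (k : K) : frameCoeff Ψ g.1 k = h.1 k := frameCoeff_eq_gramRep hG hw' g k
  have ha : Summable fun j => ‖conj (h.1 j)‖ * (w j)⁻¹ := by
    simpa only [RCLike.norm_conj] using WeightedLp.summable_norm_mul_inv h
  have hs := ((A.regular _ (Ψ.rangeProj_mem hG) w hw ∞).summable_mul_mul ha d).hasSum
  have hrow := (hs.prod_fiberwise fun k =>
    (hasSum_projRep hG hw d k).mul_left (conj (h.1 k))).congr_fun
      fun k => mul_comm ((projRep hG hw ∞ d).1 k) (conj (h.1 k))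
  have hcol (l : K) : HasSum (fun k => conj (h.1 k) * (opMatrix Ψ.rangeProj k l * d.1 l))
      (d.1 l * conj (h.1 l)) := by
    have hPh := hasSum_projRep hG hw' h l
    rw [hh, projRep_gramRep, ← hh] at hPh
    refine ((Complex.hasSum_conj'.2 hPh).mul_left (d.1 l)).congr_fun fun k => ?_
    rw [map_mul, conj_opMatrix_rangeProj]
    ring
  simp only [coorbitPairing, hgh, hrow.tsum_eq]
  exact ⟨hrow, ((Equiv.prodComm K K).hasSum_iff.2 hs).prod_fiberwise hcol⟩

include hG hw in
theorem coorbitPairing_dualCoeff_vec (k : K) (g : WeightedLp w⁻¹ 1) :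
    coorbitPairing Ψ (Ψ.dualCoeff (Ψ.vec k)) g.1 = conj (frameCoeff Ψ g.1 k) := by
  rw [← projRep_delta (p := ∞) hG hw]
  refine (hasSum_coorbitPairing_projRep hG hw _ g).2.unique ?_
  refine (WeightedLp.hasSum_mul_delta (w := w) (p := ∞)
    (fun j => conj (frameCoeff Ψ g.1 j)) k).congr_fun fun j => ?_
  exact mul_comm _ _

theorem changeWeight_gramRep_apply (c : WeightedLp w₁ p) (k : K) :
    (WeightedLp.changeWeight w₁ w₂ p (gramRep hG hw₁ p c)).1 k =
      (w₁ / w₂) k * frameCoeff Ψ c.1 k := by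
  rw [WeightedLp.changeWeight_apply, frameCoeff_eq_gramRep hG hw₁]

variable [Countable K]

variable (p) in
/-- The frame multiplier with symbol `w₁ / w₂` as a map from `H^p_{w₁}` to `H^p_{w₂}`: the Gram
matrix, followed by multiplication by the symbol and the projection onto `H^p_{w₂}`. -/
def multiplier : CoorbitSpace Ψ p w₁ →L[ℂ] CoorbitSpace Ψ p w₂ :=
  (coorbitProj hG hw₂ p) ∘L
    (WeightedLp.changeWeight w₁ w₂ p : WeightedLp w₁ p →L[ℂ] WeightedLp w₂ p) ∘L
    (gramRep hG hw₁ p) ∘L (CoorbitSpace Ψ p w₁).subtypeL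

theorem multiplier_coe (f : CoorbitSpace Ψ p w₁) : (multiplier hG hw₁ hw₂ p f).1 =
    projRep hG hw₂ p (WeightedLp.changeWeight w₁ w₂ p (gramRep hG hw₁ p f.1)) := rfl

theorem hasSum_smul_coorbitProj_delta (hp : p ≠ ∞) (f : CoorbitSpace Ψ p w₁) :
    HasSum (fun k => (((w₁ / w₂) k : ℂ) * frameCoeff Ψ f.1.1 k) •
      coorbitProj hG hw₂ p (WeightedLp.delta w₂ p k)) (multiplier hG hw₁ hw₂ p f) := by
  refine ((WeightedLp.hasSum_smul_delta hp (WeightedLp.changeWeight w₁ w₂ p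
    (gramRep hG hw₁ p f.1))).mapL (coorbitProj hG hw₂ p)).congr_fun fun k => ?_
  rw [map_smul, changeWeight_gramRep_apply hG hw₁]

theorem hasSum_mul_coorbitPairing (f : CoorbitSpace Ψ ∞ w₁) (g : WeightedLp w₂⁻¹ 1) :
    HasSum (fun k => ((w₁ / w₂) k : ℂ) * frameCoeff Ψ f.1.1 k *
      coorbitPairing Ψ (Ψ.dualCoeff (Ψ.vec k)) g.1)
      (coorbitPairing Ψ (multiplier hG hw₁ hw₂ ∞ f).1.1 g.1) := by
  refine (hasSum_coorbitPairing_projRep hG hw₂ _ g).2.congr_fun fun k => ?_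
  rw [coorbitPairing_dualCoeff_vec hG hw₂, ← changeWeight_gramRep_apply hG hw₁]
  rfl

theorem isFrameMultiplier_multiplier :
    IsFrameMultiplier Ψ (w₁ / w₂) (multiplier hG hw₁ hw₂ p) := by
  have hdelta (k : K) : (coorbitProj hG hw₂ p (WeightedLp.delta w₂ p k)).1.1 =
      Ψ.dualCoeff (Ψ.vec k) := projRep_delta hG hw₂ k
  refine ⟨fun k => coorbitProj hG hw₂ p (WeightedLp.delta w₂ p k), hdelta, fun f =>
    ⟨fun k => (hasSum_gramRep hG hw₁ f.1 k).summable,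
      fun hp => hasSum_smul_coorbitProj_delta hG hw₁ hw₂ hp f, ?_⟩⟩
  rintro rfl g
  simp only [hdelta]
  exact ⟨(hasSum_coorbitPairing_projRep hG hw₂ _ g.1).1.summable,
    hasSum_mul_coorbitPairing hG hw₁ hw₂ f g.1⟩

theorem multiplier_multiplier_coe {N : A.alg} (hGN : IsWeightConj (w₂ / w₁) Ψ.gramOp N.1)
    (f : CoorbitSpace Ψ p w₁) :
    (multiplier hG hw₂ hw₁ p (multiplier hG hw₁ hw₂ p f)).1 =
      A.rep hw₁ p (⟨Ψ.rangeProj, Ψ.rangeProj_mem hG⟩ * (N * ⟨Ψ.gramOp, Ψ.gramOp_mem hG⟩)) f.1 := by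
  rw [multiplier_coe, multiplier_coe, gramRep_projRep, map_mul, map_mul]
  exact congrArg (projRep hG hw₁ p) (ARIAlgebra.changeWeight_rep_changeWeight hw₁ hw₂
    (T := ⟨Ψ.gramOp, Ψ.gramOp_mem hG⟩) hGN (gramRep hG hw₁ p f.1))

theorem bijective_multiplier_comp_multiplier (hμ : w₁ / w₂ ∈ A.W)
    (hGμ : A.MemMatrix (conjDiag (w₂ / w₁) Ψ.gram)) :
    Function.Bijective (multiplier hG hw₂ hw₁ p ∘ multiplier hG hw₁ hw₂ p) := by
  obtain ⟨N, hN, hGN⟩ := hGμ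
  replace hGN : IsWeightConj (w₂ / w₁) Ψ.gramOp N := by rw [IsWeightConj, hGN, opMatrix_gramOp]
  obtain ⟨Y, hY, hXY⟩ := ARIAlgebra.exists_isGroupInverse_mul_mul (Ψ.gramOp_mem hG)
    Ψ.isSelfAdjoint_gramOp Ψ.isGroupInverse_gramOp hμ hN (by rwa [inv_div])
  rw [dualGramOp_mul_gramOp] at hY hXY
  let P : A.alg := ⟨Ψ.rangeProj, Ψ.rangeProj_mem hG⟩
  let X : A.alg := P * (⟨N, hN⟩ * ⟨Ψ.gramOp, Ψ.gramOp_mem hG⟩)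
  have hYmem : Y ∈ A.alg := ARIAlgebra.mem_of_isGroupInverse X.2 hY
  have hYX : Y * X.1 = Ψ.rangeProj := hY.comm.symm.trans hXY
  have hPY : Ψ.rangeProj * Y = Y := by rw [← hYX]; exact hY.mul_mul_cancel_right
  have hX (f : CoorbitSpace Ψ p w₁) :
      (multiplier hG hw₂ hw₁ p (multiplier hG hw₁ hw₂ p f)).1 = A.rep hw₁ p X f.1 :=
    multiplier_multiplier_coe hG hw₁ hw₂ hGN f
  have hP (f : CoorbitSpace Ψ p w₁) : A.rep hw₁ p P f.1 = f.1 :=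
    (mem_coorbitSpace_iff hG hw₁ f.1).1 f.2
  refine Function.bijective_iff_has_inverse.2 ⟨fun f => ⟨A.rep hw₁ p ⟨Y, hYmem⟩ f.1,
    (mem_coorbitSpace_iff hG hw₁ _).2 (ARIAlgebra.rep_apply_rep_apply_of_mul_eq hw₁ hPY f.1)⟩,
    fun f => Subtype.ext ?_, fun f => Subtype.ext ?_⟩
  · dsimp only [Function.comp_apply]
    rw [hX, ARIAlgebra.rep_apply_rep_apply_of_mul_eq hw₁ (R := P) hYX, hP]
  · rw [Function.comp_apply, hX, ARIAlgebra.rep_apply_rep_apply_of_mul_eq hw₁ (R := P) hXY, hP]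

theorem bijective_multiplier (hμ : w₁ / w₂ ∈ A.W)
    (hGμ : A.MemMatrix (conjDiag (w₁ / w₂) Ψ.gram)) :
    Function.Bijective (multiplier hG hw₁ hw₂ p) := by
  have h₁ := bijective_multiplier_comp_multiplier (p := p) hG hw₁ hw₂ hμ
    (inv_div w₁ w₂ ▸ Ψ.memMatrix_conjDiag_inv hGμ)
  have h₂ := bijective_multiplier_comp_multiplier (p := p) hG hw₂ hw₁
    (inv_div w₁ w₂ ▸ A.inv_mem _ hμ) hGμ
  exact ⟨h₁.1.of_comp, h₂.2.of_comp⟩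

variable (p) in
include hG hw₁ hw₂ in
theorem exists_continuousLinearEquiv_isFrameMultiplier (hμ : w₁ / w₂ ∈ A.W)
    (hGμ : A.MemMatrix (conjDiag (w₁ / w₂) Ψ.gram)) :
    ∃ T : CoorbitSpace Ψ p w₁ ≃L[ℂ] CoorbitSpace Ψ p w₂, IsFrameMultiplier Ψ (w₁ / w₂) T := by
  have := completeSpace_coorbitSpace hG hw₁ p
  have := completeSpace_coorbitSpace hG hw₂ p
  have hbij := bijective_multiplier (p := p) hG hw₁ hw₂ hμ hGμ
  exact ⟨.ofBijective (multiplier hG hw₁ hw₂ p) (LinearMap.ker_eq_bot.2 hbij.1)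
    (LinearMap.range_eq_top.2 hbij.2), isFrameMultiplier_multiplier hG hw₁ hw₂⟩

end HilbertFrame

end

theorem mainTheorem1 {K : Type*} [Countable K] {H : Type*} [NormedAddCommGroup H]
    [InnerProductSpace ℂ H] [CompleteSpace H]
    (A : ARIAlgebra K) (μ m : PosWeight K)
    (hμ : μ ∈ A.W) (hm₁ : m * μ.sqrt ∈ A.W) (hm₂ : m / μ.sqrt ∈ A.W)
    (Ψ : HilbertFrame K H) (hΨ : A.MemMatrix Ψ.gram) (hΨμ : A.MemMatrix (conjDiag μ Ψ.gram))
    (p : ℝ≥0∞) [Fact (1 ≤ p)] :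
    (CompleteSpace (CoorbitSpace Ψ p (m * μ.sqrt)) ∧
      CompleteSpace (CoorbitSpace Ψ p (m / μ.sqrt))) ∧
    (∃ T : CoorbitSpace Ψ p (m * μ.sqrt) ≃L[ℂ] CoorbitSpace Ψ p (m / μ.sqrt),
      IsFrameMultiplier Ψ μ T) ∧
    (∃ S : CoorbitSpace Ψ p (m / μ.sqrt) ≃L[ℂ] CoorbitSpace Ψ p (m * μ.sqrt),
      IsFrameMultiplier Ψ μ⁻¹ S) := by
  have hsymbol : m * μ.sqrt / (m / μ.sqrt) = μ :=
    (by simp : _ = μ.sqrt * μ.sqrt).trans μ.sqrt_mul_sqrt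
  have hsymbol_inv : m / μ.sqrt / (m * μ.sqrt) = μ⁻¹ := by rw [← inv_div, hsymbol]
  have hΨμ_inv : A.MemMatrix (conjDiag μ⁻¹ Ψ.gram) := Ψ.memMatrix_conjDiag_inv hΨμ
  refine ⟨⟨HilbertFrame.completeSpace_coorbitSpace hΨ hm₁ p,
    HilbertFrame.completeSpace_coorbitSpace hΨ hm₂ p⟩, ?_, ?_⟩
  · have h := HilbertFrame.exists_continuousLinearEquiv_isFrameMultiplier hΨ hm₁ hm₂ p
    rw [hsymbol] at h
    exact h hμ hΨμ
  · have h := HilbertFrame.exists_continuousLinearEquiv_isFrameMultiplier hΨ hm₂ hm₁ p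
    rw [hsymbol_inv] at h
    exact h (A.inv_mem μ hμ) hΨμ_inv
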